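/- Let $1\to A\xrightarrow{\iota}\widehat G\xrightarrow{q}G\to 1$ be a central extension of diffeological groups ($\iota$ an induction with central image $\ker q$, $q$ a subduction), and let $\mathbb Z_2=\{\pm1\}$ act smoothly by automorphisms on $G$ through $\sigma$ and on $\widehat G$ through $\widehat\sigma$, with $q\circ\widehat\sigma^{\varepsilon}=\sigma^{\varepsilon}\circ q$. Put $H_\sigma=G\rtimes_\sigma\mathbb Z_2$ and $\widehat H_{\widehat\sigma}=\widehat G\rtimes_{\widehat\sigma}\mathbb Z_2$, and let $\pi=q\times\mathrm{id}:\widehat H_{\widehat\sigma}\to H_\sigma$, whose kernel is $A$. Let $X$ be a diffeological space such that every smooth map from a D-open subset of $X$ to $G$ lifts to $\widehat G$ locally (in the D-topology). Principal bundles are understood to be locally trivial for the D-topology. Let $P\to X$ be a principal $H_\sigma$-bundle, with smooth local sections $s_i$ over the members of a D-open cover $(U_i)$ of $X$ and smooth transition functions $h_{ij}=(g_{ij},\varepsilon_{ij}):U_{ij}\to H_\sigma$, $s_j=s_i\,h_{ij}$. Let $\alpha=[\varepsilon_{ij}]\in H^1(X;\mathbb Z_2)$, and let $A_\alpha$ be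 the local system obtained by gluing the sheaves of smooth $A$-valued functions on the $U_i$ through the cocycle $(\varepsilon_{ij})$, where $\mathbb Z_2$ acts on $A$ through $\widehat\sigma$: its sections over $U$ are the families of smooth maps $a_i:U\cap U_i\to A$ with $a_i=\widehat\sigma^{\varepsilon_{ij}}(a_j)$ on $U\cap U_{ij}$. Let $\mathcal G(P,\widehat H_{\widehat\sigma})$ assign to every D-open $U\subset X$ the groupoid whose objects are the principal $\widehat H_{\widehat\sigma}$-bundles $\widehat P_U\to U$ equipped with an isomorphism $\widehat P_U/A\simeq P|_U$ and whose morphisms are the isomorphisms of $\widehat H_{\widehat\sigma}$-bundles compatible with the projections to $P|_U$. Then: 1. $\mathcal G(P,\widehat H_{\widehat\sigma})$, with its restriction functors, is a gerbe on $X$, that is, a stack in groupoids which is locally non-empty and locally connected. 2. It is banded by $A_\alpha$: $A_\alpha$ is a sheaf of abelian groups, and there are isomorphisms $A_\alpha(U)\simeq\operatorname{Aut}(\widehat P_U)$, compatible with restrictions and with the isomorphisms of lifts, under which $a=(a_i)$ acts as right multiplication by $a_i$ on the points of $\widehat P_U$ lying above the section $s_i$ of $P$. 3. For every choice of smooth lifts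 $\widehat g_{ij}:U_{ij}\to\widehat G$ of the $g_{ij}$, the functions $$a_{ijk}=\widehat g_{ij}\,\widehat\sigma^{\varepsilon_{ij}}(\widehat g_{jk})\,\widehat g_{ik}^{-1}$$ take values in $A$ and, read on $U_{ijk}$ in the $i$-th frame of $A_\alpha$, form a Čech $2$-cocycle with coefficients in $A_\alpha$, and its class $[a]$ in the Čech cohomology $H^2(X;A_\alpha)$ (the colimit over open covers) is the class of the $A_\alpha$-banded gerbe $\mathcal G(P,\widehat H_{\widehat\sigma})$. That is: there are an open cover $(V_m)$, objects $x_m\in\mathcal G(V_m)$ and isomorphisms $f_{mn}:x_n|_{V_{mn}}\to x_m|_{V_{mn}}$; and for all such choices, the sections $c_{mnl}$ of $A_\alpha$ over $V_{mnl}$ which correspond to the automorphisms $f_{mn}f_{nl}f_{ml}^{-1}$ of $x_m|_{V_{mnl}}$ form a Čech $2$-cocycle of class $[a]$. -/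

import Mathlib

open CategoryTheory TopologicalSpace Opposite Diffeology

universe u v' u'

noncomputable section

/-! ### Diffeologies -/

namespace DiffGerbe

/-- The coarsest diffeology for which `f` is smooth. -/
@[reducible]
def inducedDiffeology {X Y : Type*} [DiffeologicalSpace Y] (f : X → Y) : DiffeologicalSpace X where
  plots n := {p | IsPlot (f ∘ p)}
  constant_plots x := isPlot_const (x := f x)
  plot_reparam hp hf := isPlot_reparam hp hf
  locality h := DiffeologicalSpace.locality fun x ↦ by
    obtain ⟨s, hs, hx, h⟩ := h x
    exact ⟨s, hs, hx, fun hf hf' ↦ h hf hf'⟩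

/-- The subset diffeology. -/
instance instSubtype {X : Type*} [DiffeologicalSpace X] (p : X → Prop) :
    DiffeologicalSpace {x // p x} :=
  inducedDiffeology Subtype.val

/-- The product diffeology. -/
instance instProd {X Y : Type*} [DiffeologicalSpace X] [DiffeologicalSpace Y] :
    DiffeologicalSpace (X × Y) where
  plots n := {p | IsPlot (fun t ↦ (p t).1) ∧ IsPlot (fun t ↦ (p t).2)}
  constant_plots x := ⟨isPlot_const, isPlot_const⟩
  plot_reparam hp hf := ⟨isPlot_reparam hp.1 hf, isPlot_reparam hp.2 hf⟩
  locality h := by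
    constructor <;> refine DiffeologicalSpace.locality fun x ↦ ?_ <;>
      obtain ⟨s, hs, hx, h⟩ := h x
    · exact ⟨s, hs, hx, fun hf hf' ↦ (h hf hf').1⟩
    · exact ⟨s, hs, hx, fun hf hf' ↦ (h hf hf').2⟩

/-- Every point of an open set `O` has a neighbourhood on which the identity agrees with a smooth map
from the whole space to `O`. -/
lemma exists_smooth_retract {n : ℕ} {O : Set (EuclideanSpace ℝ (Fin n))} (hO : IsOpen O)
    {t : EuclideanSpace ℝ (Fin n)} (ht : t ∈ O) :
    ∃ φ : EuclideanSpace ℝ (Fin n) → EuclideanSpace ℝ (Fin n), ContDiff ℝ (⊤ : ℕ∞) φ ∧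
      (∀ s, φ s ∈ O) ∧ ∃ W : Set (EuclideanSpace ℝ (Fin n)), IsOpen W ∧ t ∈ W ∧
        ∀ s ∈ W, φ s = s := by
  obtain ⟨ε, hε, hb⟩ := Metric.isOpen_iff.mp hO t ht
  let χ : ContDiffBump t := ⟨ε / 2, ε, half_pos hε, half_lt_self hε⟩
  refine ⟨fun s ↦ t + χ s • (s - t), ?_, fun s ↦ hb ?_, Metric.ball t (ε / 2), Metric.isOpen_ball,
    Metric.mem_ball_self (half_pos hε), fun s hs ↦ ?_⟩
  · exact contDiff_const.add (χ.contDiff.smul (contDiff_id.sub contDiff_const))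
  · rw [Metric.mem_ball, dist_eq_norm, add_sub_cancel_left, norm_smul, Real.norm_eq_abs,
      abs_of_nonneg χ.nonneg]
    by_cases hs : dist s t < ε
    · refine lt_of_le_of_lt (mul_le_of_le_one_left (norm_nonneg _) χ.le_one) ?_
      rwa [← dist_eq_norm]
    · rw [χ.zero_of_le_dist (not_lt.mp hs), zero_mul]
      exact hε
  · have : χ s = 1 := χ.one_of_mem_closedBall (Metric.ball_subset_closedBall hs)
    simp [this]

/-- The discrete diffeology: since every `ℝⁿ` is connected, its plots `ℝⁿ → X` (the locally
constant maps) are the constant ones. -/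
@[reducible]
def discreteDiffeology (X : Type*) : DiffeologicalSpace X where
  plots n := {p | ∀ s t, p s = p t}
  constant_plots x := fun _ _ ↦ rfl
  plot_reparam hp _ := fun _ _ ↦ hp _ _
  locality {n p} h := by
    have hl : IsLocallyConstant p := by
      refine (IsLocallyConstant.iff_exists_open p).2 fun x ↦ ?_
      obtain ⟨s, hs, hx, h⟩ := h x
      obtain ⟨ε, hε, hb⟩ := Metric.isOpen_iff.mp hs x hx
      refine ⟨_, Metric.isOpen_ball, Metric.mem_ball_self hε, fun y hy ↦ ?_⟩
      have hmem : ∀ z, OpenPartialHomeomorph.univBall x ε z ∈ Metric.ball x ε := fun z ↦ by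
        have := (OpenPartialHomeomorph.univBall x ε).map_source (x := z) (by simp)
        rwa [OpenPartialHomeomorph.univBall_target x hε] at this
      have hc := h (f := OpenPartialHomeomorph.univBall x ε) (fun z ↦ hb (hmem z))
        OpenPartialHomeomorph.contDiff_univBall
      have hinv : ∀ z ∈ Metric.ball x ε, OpenPartialHomeomorph.univBall x ε
          ((OpenPartialHomeomorph.univBall x ε).symm z) = z := fun z hz ↦
        (OpenPartialHomeomorph.univBall x ε).right_inv
          (by rwa [OpenPartialHomeomorph.univBall_target x hε])
      have := hc ((OpenPartialHomeomorph.univBall x ε).symm y)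
        ((OpenPartialHomeomorph.univBall x ε).symm x)
      simpa [Function.comp, hinv y hy, hinv x (Metric.mem_ball_self hε)] using this
    exact fun s t ↦ hl.apply_eq_of_preconnectedSpace s t

/-- `ℤ₂ = {±1}` is a discrete diffeological group. -/
instance : DiffeologicalSpace ℤˣ := discreteDiffeology ℤˣ

instance instSemidirect {N K : Type*} [Group N] [Group K] (φ : K →* MulAut N)
    [DiffeologicalSpace N] [DiffeologicalSpace K] : DiffeologicalSpace (N ⋊[φ] K) :=
  inducedDiffeology (fun z ↦ (z.left, z.right))

/-- Diffeological groups. -/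
class DiffeologicalGroup (G : Type*) [Group G] [DiffeologicalSpace G] : Prop where
  smooth_mul : DSmooth (fun z : G × G ↦ z.1 * z.2)
  smooth_inv : DSmooth (fun g : G ↦ g⁻¹)

/-- `f` is a subduction onto the subset `S` of `Y`, equipped with the subset diffeology:
it is smooth with values in `S` and every plot of `S` lifts locally to a plot of `X`. -/
def IsSubductionOnto {X Y : Type*} [DiffeologicalSpace X] [DiffeologicalSpace Y] (f : X → Y)
    (S : Set Y) : Prop :=
  DSmooth f ∧ (∀ x, f x ∈ S) ∧
    ∀ (n : ℕ) (p : EuclideanSpace ℝ (Fin n) → Y), IsPlot p → (∀ t, p t ∈ S) →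
      ∀ t, ∃ O : Set (EuclideanSpace ℝ (Fin n)), IsOpen O ∧ t ∈ O ∧
        ∃ p' : EuclideanSpace ℝ (Fin n) → X, IsPlot p' ∧ ∀ s ∈ O, f (p' s) = p s

/-! ### Central extensions with a compatible action of `ℤ₂` -/

/-- A central extension `1 → A → Ĝ → G → 1` of diffeological groups (`ι` is an induction, `q` a
subduction), with smooth actions `σ` on `G` and `σhat` on `Ĝ` of `ℤ₂` such that
`q ∘ σhat ε = σ ε ∘ q`. -/
structure TwistedCentralExtension (A Ghat G : Type u) [CommGroup A] [Group Ghat] [Group G]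
    [DiffeologicalSpace A] [DiffeologicalSpace Ghat] [DiffeologicalSpace G] where
  ι : A →* Ghat
  q : Ghat →* G
  ι_injective : Function.Injective ι
  ι_induction : ∀ (n : ℕ) (p : EuclideanSpace ℝ (Fin n) → A), IsPlot p ↔ IsPlot (ι ∘ p)
  q_subduction : IsSubductionOnto q Set.univ
  exact : ι.range = q.ker
  central : ι.range ≤ Subgroup.center Ghat
  σ : ℤˣ →* MulAut G
  σhat : ℤˣ →* MulAut Ghat
  smooth_σ : ∀ ε, DSmooth (σ ε)
  smooth_σhat : ∀ ε, DSmooth (σhat ε)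
  q_σhat : ∀ ε g, q (σhat ε g) = σ ε (q g)

namespace TwistedCentralExtension

variable {A Ghat G : Type u} [CommGroup A] [Group Ghat] [Group G]
    [DiffeologicalSpace A] [DiffeologicalSpace Ghat] [DiffeologicalSpace G]
    (E : TwistedCentralExtension A Ghat G)

/-- `H_σ = G ⋊ ℤ₂`. -/
abbrev H : Type u := G ⋊[E.σ] ℤˣ

/-- `Ĥ_σ̂ = Ĝ ⋊ ℤ₂`. -/
abbrev Hhat : Type u := Ghat ⋊[E.σhat] ℤˣ

/-- The projection `Ĥ → H`, `(g, ε) ↦ (q g, ε)`. -/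
def π : E.Hhat →* E.H :=
  SemidirectProduct.map E.q (MonoidHom.id ℤˣ) fun ε ↦ by
    ext g; exact E.q_σhat ε g

/-- The inclusion `A → Ĥ`, `a ↦ (a, 1)`; its range is the kernel of `π`. -/
def incl : A →* E.Hhat := SemidirectProduct.inl.comp E.ι

/-- Smooth maps to `G` from D-open subsets of `X` lift locally to `Ĝ`, i.e. the sequence
`1 → A → Ĝ → G → 1` remains exact for the sheaves of smooth maps on `X`. -/
def LiftsLocallyOn (X : Type u) [TopologicalSpace X] [DiffeologicalSpace X] : Prop :=
  ∀ (U : Opens X) (g : U → G), DSmooth g → ∀ x : U, ∃ (V : Opens X) (hV : V ≤ U), x.1 ∈ V ∧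
    ∃ g' : V → Ghat, DSmooth g' ∧ ∀ y : V, E.q (g' y) = g ⟨y.1, hV y.2⟩

end TwistedCentralExtension

/-! ### Principal bundles -/

section Bundles

variable {X : Type u} [TopologicalSpace X] [DiffeologicalSpace X]

/-- A (diffeological, locally trivial) principal right `H`-bundle over the open subset `U` of
`X`. -/
structure PrincipalBundle (H : Type u) [Group H] [DiffeologicalSpace H] (U : Opens X) where
  Total : Type u
  [diffeology : DiffeologicalSpace Total]
  proj : Total → X
  proj_mem : ∀ p, proj p ∈ U
  smooth_proj : DSmooth proj
  act : Total → H → Total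
  act_one : ∀ p, act p 1 = p
  act_mul : ∀ p h k, act p (h * k) = act (act p h) k
  smooth_act : DSmooth (fun z : Total × H ↦ act z.1 z.2)
  proj_act : ∀ p h, proj (act p h) = proj p
  locally_trivial : ∀ x ∈ U, ∃ V : Opens X, x ∈ V ∧ V ≤ U ∧
    ∃ e : V × H ≃ {p : Total // proj p ∈ V}, DSmooth e ∧ DSmooth e.symm ∧
      (∀ z, proj (e z).1 = z.1.1) ∧ ∀ x h k, (e (x, h * k)).1 = act (e (x, h)).1 k

attribute [instance] PrincipalBundle.diffeology

namespace PrincipalBundle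

variable {H : Type u} [Group H] [DiffeologicalSpace H] {U : Opens X}

lemma act_free (P : PrincipalBundle H U) {p : P.Total} {h k : H}
    (hk : P.act p h = P.act p k) : h = k := by
  obtain ⟨V, hx, -, e, -, -, -, he⟩ := P.locally_trivial (P.proj p) (P.proj_mem p)
  obtain ⟨⟨x, l⟩, hz⟩ := e.surjective ⟨p, hx⟩
  have hp : p = (e (x, l)).1 := by rw [hz]
  rw [hp, ← he, ← he] at hk
  have := e.injective (Subtype.ext hk)
  simpa using this

/-- The restriction of a principal bundle to a smaller open subset. -/
def restrict (P : PrincipalBundle H U) {V : Opens X} (hV : V ≤ U) : PrincipalBundle H V where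
  Total := {p : P.Total // P.proj p ∈ V}
  proj p := P.proj p.1
  proj_mem p := p.2
  smooth_proj n p hp := P.smooth_proj n _ hp
  act p h := ⟨P.act p.1 h, by rw [P.proj_act]; exact p.2⟩
  act_one p := Subtype.ext (P.act_one _)
  act_mul p h k := Subtype.ext (P.act_mul _ _ _)
  smooth_act n p hp := P.smooth_act n (fun t ↦ ((p t).1.1, (p t).2)) hp
  proj_act p h := P.proj_act _ _
  locally_trivial x hx := by
    obtain ⟨W, hxW, -, e, h1, h2, h3, h4⟩ := P.locally_trivial x (hV hx)
    refine ⟨W ⊓ V, ⟨hxW, hx⟩, inf_le_right, 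
      { toFun := fun z ↦ ⟨⟨(e (⟨z.1.1, z.1.2.1⟩, z.2)).1, by rw [h3]; exact z.1.2.2⟩, by
          rw [h3]; exact z.1.2⟩
        invFun := fun p ↦ (⟨P.proj p.1.1, p.2⟩, (e.symm ⟨p.1.1, p.2.1⟩).2)
        left_inv := fun z ↦ by
          refine Prod.ext (Subtype.ext (h3 _)) ?_
          simp
        right_inv := fun p ↦ by
          refine Subtype.ext (Subtype.ext ?_)
          have h5 : e (e.symm ⟨p.1.1, p.2.1⟩) = ⟨p.1.1, p.2.1⟩ := e.apply_symm_apply _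
          have h6 : (e.symm ⟨p.1.1, p.2.1⟩).1.1 = P.proj p.1.1 := by rw [← h3, h5]
          have h7 : ((⟨P.proj p.1.1, p.2.1⟩ : W), (e.symm ⟨p.1.1, p.2.1⟩).2) =
              e.symm ⟨p.1.1, p.2.1⟩ := Prod.ext (Subtype.ext h6.symm) rfl
          change (e _).1 = _
          rw [h7, h5] },
      fun n p hp ↦ h1 n (fun t ↦ (⟨(p t).1.1, (p t).1.2.1⟩, (p t).2)) hp,
      fun n p hp ↦ ⟨P.smooth_proj n _ hp, (h2 n (fun t ↦ ⟨(p t).1.1, (p t).2.1⟩) hp).2⟩,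
      fun z ↦ h3 _, fun x h k ↦ Subtype.ext (h4 _ _ _)⟩

end PrincipalBundle

/-! ### Covers, twisting cocycles and transition functions -/

variable (X) in
/-- Open covers of `X`. -/
structure Cover where
  idx : Type u
  set : idx → Opens X
  covers : ⨆ i, set i = ⊤

variable (X) in
/-- A Čech `1`-cocycle with values in `ℤ₂`. -/
structure Z2Cocycle where
  cover : Cover X
  ε : ∀ i j, ↥(cover.set i ⊓ cover.set j) → ℤˣ
  smooth_ε : ∀ i j, DSmooth (ε i j)
  cocycle : ∀ i j k (x : X) (hi : x ∈ cover.set i) (hj : x ∈ cover.set j) (hk : x ∈ cover.set k),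
    ε i j ⟨x, hi, hj⟩ * ε j k ⟨x, hj, hk⟩ = ε i k ⟨x, hi, hk⟩

variable {A Ghat G : Type u} [CommGroup A] [Group Ghat] [Group G]
    [DiffeologicalSpace A] [DiffeologicalSpace Ghat] [DiffeologicalSpace G]
    {E : TwistedCentralExtension A Ghat G}

/-- Local sections `s i` of `P` over an open cover of `X`, and the corresponding transition
functions `h i j = (g i j, ε i j)`, determined by `s j = s i · h i j`. -/
structure Trivialization (P : PrincipalBundle E.H (⊤ : Opens X)) where
  cover : Cover X
  s : ∀ i, ↥(cover.set i) → P.Total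
  smooth_s : ∀ i, DSmooth (s i)
  proj_s : ∀ i x, P.proj (s i x) = x.1
  g : ∀ i j, ↥(cover.set i ⊓ cover.set j) → G
  ε : ∀ i j, ↥(cover.set i ⊓ cover.set j) → ℤˣ
  smooth_g : ∀ i j, DSmooth (g i j)
  smooth_ε : ∀ i j, DSmooth (ε i j)
  transition : ∀ i j x, s j ⟨x.1, x.2.2⟩ = P.act (s i ⟨x.1, x.2.1⟩) ⟨g i j x, ε i j x⟩

namespace Trivialization

variable {P : PrincipalBundle E.H (⊤ : Opens X)} (T : Trivialization P)

/-- `h i j * h j k = h i k`. -/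
lemma cocycle (i j k) (x : X) (hi : x ∈ T.cover.set i) (hj : x ∈ T.cover.set j)
    (hk : x ∈ T.cover.set k) :
    (⟨T.g i j ⟨x, hi, hj⟩, T.ε i j ⟨x, hi, hj⟩⟩ * ⟨T.g j k ⟨x, hj, hk⟩, T.ε j k ⟨x, hj, hk⟩⟩ : E.H)
      = ⟨T.g i k ⟨x, hi, hk⟩, T.ε i k ⟨x, hi, hk⟩⟩ := by
  refine P.act_free (p := T.s i ⟨x, hi⟩) ?_
  rw [P.act_mul, ← T.transition i j ⟨x, hi, hj⟩, ← T.transition i k ⟨x, hi, hk⟩,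
    ← T.transition j k ⟨x, hj, hk⟩]

/-- The cocycle `(ε i j)`, which represents the twisting class `α(P) ∈ H¹(X; ℤ₂)`. -/
def twist : Z2Cocycle X where
  cover := T.cover
  ε := T.ε
  smooth_ε := T.smooth_ε
  cocycle i j k x hi hj hk := congrArg SemidirectProduct.right (T.cocycle i j k x hi hj hk)

/-- A choice of smooth lifts `ĝ i j : U_ij → Ĝ` of the components `g i j : U_ij → G`. -/
structure Lifts where
  g : ∀ i j, ↥(T.cover.set i ⊓ T.cover.set j) → Ghat
  smooth_g : ∀ i j, DSmooth (g i j)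
  lifts : ∀ i j x, E.q (g i j x) = T.g i j x

end Trivialization

/-! ### The local system `A_α` -/

section LocalSystem

variable [DiffeologicalGroup A]

variable (E) in
/-- Sections over `U` of the local system obtained by gluing the sheaves of smooth `A`-valued
functions on the members `U_i` of the cover through the action of the cocycle `ε`: families of
smooth functions `a_i : U ∩ U_i → A` such that `a_i = ε_ij · a_j` on `U ∩ U_i ∩ U_j`. Here `ℤ₂`
acts on `A ⊆ Ĝ` through `σhat`. -/
def localSections (z : Z2Cocycle X) (U : Opens X) :
    Subgroup (∀ i, ↥(U ⊓ z.cover.set i) → A) where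
  carrier := {a | (∀ i, DSmooth (a i)) ∧
    ∀ i j (x : X) (hU : x ∈ U) (hi : x ∈ z.cover.set i) (hj : x ∈ z.cover.set j),
      E.ι (a i ⟨x, hU, hi⟩) = E.σhat (z.ε i j ⟨x, hi, hj⟩) (E.ι (a j ⟨x, hU, hj⟩))}
  one_mem' := ⟨fun _ ↦ dSmooth_const, fun _ _ _ _ _ _ ↦ by simp⟩
  mul_mem' {a b} ha hb := ⟨fun i n p hp ↦ DiffeologicalGroup.smooth_mul n
      (fun t ↦ (a i (p t), b i (p t))) ⟨ha.1 i n p hp, hb.1 i n p hp⟩,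
    fun i j x hU hi hj ↦ by
      simp only [Pi.mul_apply, map_mul, ha.2 i j x hU hi hj, hb.2 i j x hU hi hj]⟩
  inv_mem' {a} ha := ⟨fun i ↦ DiffeologicalGroup.smooth_inv.comp (ha.1 i),
    fun i j x hU hi hj ↦ by simp only [Pi.inv_apply, map_inv, ha.2 i j x hU hi hj]⟩

variable (E) in
/-- The local system `A_α`, where `α` is the class of the cocycle `z`. -/
def localSystem (z : Z2Cocycle X) : (Opens X)ᵒᵖ ⥤ CommGrpCat.{u} where
  obj U := CommGrpCat.of (localSections E z U.unop)
  map {U V} f := CommGrpCat.ofHom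
    { toFun := fun a ↦ ⟨fun i x ↦ a.1 i ⟨x.1, f.unop.le x.2.1, x.2.2⟩,
        fun i n p hp ↦ a.2.1 i n (fun t ↦ ⟨(p t).1, f.unop.le (p t).2.1, (p t).2.2⟩) hp,
        fun i j x hU hi hj ↦ a.2.2 i j x (f.unop.le hU) hi hj⟩
      map_one' := rfl
      map_mul' := fun _ _ ↦ rfl }

/-- The component `a_i : U ∩ U_i → A` of a section `a` of `A_α` over `U`. -/
def component {z : Z2Cocycle X} {U : Opens X} (a : (localSystem E z).obj (op U))
    (i : z.cover.idx) (x : X) (hU : x ∈ U) (hi : x ∈ z.cover.set i) : A :=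
  (show localSections E z U from a).1 i ⟨x, hU, hi⟩

end LocalSystem

end Bundles

/-! ### Čech cohomology in degree two -/

section Cech

variable {X : Type u} [TopologicalSpace X] (F : (Opens X)ᵒᵖ ⥤ CommGrpCat.{u})

/-- The restriction maps of a presheaf. -/
def res {U V : Opens X} (h : V ≤ U) : F.obj (op U) →* F.obj (op V) :=
  (F.map (homOfLE h).op).hom

lemma mul_aux₁ {M : Type*} [CommGroup M] (a a' b b' c c' : M) :
    (a * a') * (b * b')⁻¹ * (c * c') = (a * b⁻¹ * c) * (a' * b'⁻¹ * c') := by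
  rw [mul_inv, mul_mul_mul_comm a, mul_mul_mul_comm]

lemma mul_aux₂ {M : Type*} [CommGroup M] (a a' b b' c c' d d' : M) :
    (a * a') * (b * b')⁻¹ * (c * c') * (d * d')⁻¹ =
      (a * b⁻¹ * c * d⁻¹) * (a' * b'⁻¹ * c' * d'⁻¹) := by
  rw [mul_aux₁, mul_inv d, mul_mul_mul_comm]

namespace Cover

variable (𝒰 : Cover X)

abbrev inter₂ (i j : 𝒰.idx) : Opens X := 𝒰.set i ⊓ 𝒰.set j

abbrev inter₃ (i j k : 𝒰.idx) : Opens X := 𝒰.set i ⊓ 𝒰.set j ⊓ 𝒰.set k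

abbrev inter₄ (i j k l : 𝒰.idx) : Opens X := 𝒰.set i ⊓ 𝒰.set j ⊓ 𝒰.set k ⊓ 𝒰.set l

lemma le_jk (i j k) : 𝒰.inter₃ i j k ≤ 𝒰.inter₂ j k := fun _ h ↦ ⟨h.1.2, h.2⟩

lemma le_ik (i j k) : 𝒰.inter₃ i j k ≤ 𝒰.inter₂ i k := fun _ h ↦ ⟨h.1.1, h.2⟩

lemma le_ij (i j k) : 𝒰.inter₃ i j k ≤ 𝒰.inter₂ i j := fun _ h ↦ h.1

lemma le_jkl (i j k l) : 𝒰.inter₄ i j k l ≤ 𝒰.inter₃ j k l :=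
  fun _ h ↦ ⟨⟨h.1.1.2, h.1.2⟩, h.2⟩

lemma le_ikl (i j k l) : 𝒰.inter₄ i j k l ≤ 𝒰.inter₃ i k l :=
  fun _ h ↦ ⟨⟨h.1.1.1, h.1.2⟩, h.2⟩

lemma le_ijl (i j k l) : 𝒰.inter₄ i j k l ≤ 𝒰.inter₃ i j l := fun _ h ↦ ⟨h.1.1, h.2⟩

lemma le_ijk (i j k l) : 𝒰.inter₄ i j k l ≤ 𝒰.inter₃ i j k := fun _ h ↦ h.1

/-- Čech `n`-cochains for `n = 1, 2, 3`. -/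
abbrev C1 : Type u := ∀ i j, F.obj (op (𝒰.inter₂ i j))

abbrev C2 : Type u := ∀ i j k, F.obj (op (𝒰.inter₃ i j k))

abbrev C3 : Type u := ∀ i j k l, F.obj (op (𝒰.inter₄ i j k l))

/-- `(d b)_ijk = b_jk b_ik⁻¹ b_ij`. -/
def d1 : 𝒰.C1 F →* 𝒰.C2 F where
  toFun b i j k := res F (𝒰.le_jk i j k) (b j k) * (res F (𝒰.le_ik i j k) (b i k))⁻¹ *
    res F (𝒰.le_ij i j k) (b i j)
  map_one' := by funext i j k; simp
  map_mul' b c := by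
    funext i j k
    simp only [Pi.mul_apply, map_mul]
    exact mul_aux₁ _ _ _ _ _ _

/-- `(d c)_ijkl = c_jkl c_ikl⁻¹ c_ijl c_ijk⁻¹`. -/
def d2 : 𝒰.C2 F →* 𝒰.C3 F where
  toFun c i j k l := res F (𝒰.le_jkl i j k l) (c j k l) * (res F (𝒰.le_ikl i j k l) (c i k l))⁻¹ *
    res F (𝒰.le_ijl i j k l) (c i j l) * (res F (𝒰.le_ijk i j k l) (c i j k))⁻¹
  map_one' := by funext i j k l; simp
  map_mul' b c := by
    funext i j k l
    simp only [Pi.mul_apply, map_mul]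
    exact mul_aux₂ _ _ _ _ _ _ _ _

/-- Čech `2`-cocycles. -/
abbrev Z2 : Subgroup (𝒰.C2 F) := (𝒰.d2 F).ker

/-- Čech `2`-coboundaries. -/
abbrev B2 : Subgroup (𝒰.C2 F) := (𝒰.d1 F).range

/-- Refinements of covers. -/
structure Refines (𝒱 𝒰 : Cover X) where
  idx : 𝒱.idx → 𝒰.idx
  le : ∀ m, 𝒱.set m ≤ 𝒰.set (idx m)

/-- Restriction of `2`-cochains to a refinement. -/
def pull {𝒱 𝒰 : Cover X} (r : Refines 𝒱 𝒰) (c : 𝒰.C2 F) : 𝒱.C2 F :=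
  fun i j k ↦ res F (inf_le_inf (inf_le_inf (r.le i) (r.le j)) (r.le k))
    (c (r.idx i) (r.idx j) (r.idx k))

end Cover

/-- Two `2`-cocycles, on possibly different covers, become cohomologous on a common refinement. -/
def CechRel (c d : Σ 𝒰 : Cover X, 𝒰.Z2 F) : Prop :=
  ∃ (𝒲 : Cover X) (r : Cover.Refines 𝒲 c.1) (t : Cover.Refines 𝒲 d.1),
    Cover.pull F r c.2.1 / Cover.pull F t d.2.1 ∈ 𝒲.B2 F

/-- The Čech cohomology `H²(X; F)`, the colimit of `Z²(𝒰; F) / B²(𝒰; F)` over the open covers `𝒰`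
of `X`, ordered by refinement. -/
def CechH2 : Type _ := Quot (CechRel F)

/-- The class in `H²(X; F)` of a Čech `2`-cocycle. -/
def CechH2.mk {F : (Opens X)ᵒᵖ ⥤ CommGrpCat.{u}} {𝒰 : Cover X} (c : 𝒰.Z2 F) : CechH2 F :=
  Quot.mk _ ⟨𝒰, c⟩

end Cech

/-! ### Gerbes, bands and their classes -/

section Gerbes

variable {X : Type u} [TopologicalSpace X]
  (𝒢 : Pseudofunctor (LocallyDiscrete (Opens X)ᵒᵖ) Cat.{v', u'})

/-- The category of sections over `U`. -/
abbrev Sec (U : Opens X) : Type u' := 𝒢.obj (.mk (op U))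

/-- The restriction functors. -/
abbrev resF {U V : Opens X} (h : V ≤ U) : Sec 𝒢 U ⥤ Sec 𝒢 V :=
  (𝒢.map (homOfLE h).op.toLoc).toFunctor

/-- Gerbes on `X`: stacks in groupoids which are locally non-empty and locally connected. -/
structure IsGerbe : Prop where
  isStack : 𝒢.IsStack (Opens.grothendieckTopology X)
  isIso : ∀ (U : Opens X) (x y : Sec 𝒢 U) (f : x ⟶ y), IsIso f
  locally_nonempty : ∀ x : X, ∃ U : Opens X, x ∈ U ∧ Nonempty (Sec 𝒢 U)
  locally_connected : ∀ (U : Opens X) (a b : Sec 𝒢 U), ∀ x ∈ U,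
    ∃ (V : Opens X) (h : V ≤ U), x ∈ V ∧ Nonempty ((resF 𝒢 h).obj a ≅ (resF 𝒢 h).obj b)

/-- A banding of `𝒢` by the sheaf of abelian groups `F`: isomorphisms `F|_U ≅ Aut(x)` for all local
objects `x ∈ 𝒢(U)`, compatible with restrictions and with the isomorphisms of `𝒢`. -/
structure Banding (F : (Opens X)ᵒᵖ ⥤ CommGrpCat.{u}) where
  isSheaf : Presheaf.IsSheaf (Opens.grothendieckTopology X) F
  iso : ∀ {U : Opens X} (x : Sec 𝒢 U), F.obj (op U) ≃* Aut x
  naturality : ∀ {U : Opens X} {x y : Sec 𝒢 U} (f : x ⟶ y) (a : F.obj (op U)),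
    (iso x a).hom ≫ f = f ≫ (iso y a).hom
  restrict : ∀ {U V : Opens X} (h : V ≤ U) (x : Sec 𝒢 U) (a : F.obj (op U)),
    (iso ((resF 𝒢 h).obj x) (res F h a)).hom = (resF 𝒢 h).map (iso x a).hom

/-- Local objects `x_i ∈ 𝒢(U_i)` over an open cover and isomorphisms `f_ij : x_j ≅ x_i` over
`U_ij`. -/
structure GerbeChoice where
  cover : Cover X
  x : ∀ i, Sec 𝒢 (cover.set i)
  f : ∀ i j, (resF 𝒢 (inf_le_right : cover.inter₂ i j ≤ _)).obj (x j) ≅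
    (resF 𝒢 (inf_le_left : cover.inter₂ i j ≤ _)).obj (x i)

namespace GerbeChoice

variable {𝒢} (D : GerbeChoice 𝒢)

/-- The restriction to `W ⊆ U_ij` of the isomorphism `f_ij`, as a morphism `x_j|_W ⟶ x_i|_W`. -/
def fRes (i j) {W : Opens X} (hi : W ≤ D.cover.set i) (hj : W ≤ D.cover.set j) :
    (resF 𝒢 hj).obj (D.x j) ⟶ (resF 𝒢 hi).obj (D.x i) :=
  Pseudofunctor.LocallyDiscreteOpToCat.pullHom (F := 𝒢)
    (f₁ := homOfLE inf_le_right) (f₂ := homOfLE inf_le_left) (D.f i j).hom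
    (homOfLE (le_inf hi hj)) (homOfLE hj) (homOfLE hi)

/-- `c` is the `2`-cochain of the choices `D`: over `U_ijk`, the automorphism of `x_i` given by
`c_ijk` is `f_ij ∘ f_jk ∘ f_ik⁻¹`. -/
def HasCochain {F : (Opens X)ᵒᵖ ⥤ CommGrpCat.{u}} (θ : Banding 𝒢 F) (c : D.cover.C2 F) : Prop :=
  ∀ i j k,
    have hi : D.cover.inter₃ i j k ≤ D.cover.set i := fun _ h ↦ h.1.1
    have hj : D.cover.inter₃ i j k ≤ D.cover.set j := fun _ h ↦ h.1.2
    have hk : D.cover.inter₃ i j k ≤ D.cover.set k := fun _ h ↦ h.2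
    D.fRes i k hi hk ≫ (θ.iso ((resF 𝒢 hi).obj (D.x i)) (c i j k)).hom =
      D.fRes j k hj hk ≫ D.fRes i j hi hj

end GerbeChoice

/-- `β ∈ H²(X; F)` is the class of the gerbe `𝒢` banded by `F`: local objects and isomorphisms
`f_ij` can be chosen as above over some open cover, and the `2`-cochain of every such choice is a
Čech cocycle which represents `β`. -/
def IsGerbeClass {𝒢 : Pseudofunctor (LocallyDiscrete (Opens X)ᵒᵖ) Cat.{v', u'}}
    {F : (Opens X)ᵒᵖ ⥤ CommGrpCat.{u}} (θ : Banding 𝒢 F) (β : CechH2 F) : Prop :=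
  Nonempty (GerbeChoice 𝒢) ∧
    ∀ D : GerbeChoice 𝒢, ∃ c : D.cover.Z2 F, D.HasCochain θ c.1 ∧ CechH2.mk c = β

end Gerbes

/-! ### The lifting gerbe -/

section Lifting

variable {X : Type u} [TopologicalSpace X] [DiffeologicalSpace X]
  {A Ghat G : Type u} [CommGroup A] [Group Ghat] [Group G]
  [DiffeologicalSpace A] [DiffeologicalSpace Ghat] [DiffeologicalSpace G]
  {E : TwistedCentralExtension A Ghat G}

/-- A lift of `P` over the open subset `U`: a principal `Ĥ`-bundle `P̂` over `U` with an isomorphism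
`P̂ / A ≅ P|_U` of principal `H`-bundles. The isomorphism is given by the composite
`toBase : P̂ → P̂ / A ≅ P|_U`: a map over `U`, equivariant along `Ĥ → H`, whose fibres are
the `A`-orbits and which is a subduction onto `P|_U`. -/
structure LocalLift (P : PrincipalBundle E.H (⊤ : Opens X)) (U : Opens X) where
  bundle : PrincipalBundle E.Hhat U
  toBase : bundle.Total → P.Total
  proj_toBase : ∀ p, P.proj (toBase p) = bundle.proj p
  toBase_act : ∀ p h, toBase (bundle.act p h) = P.act (toBase p) (E.π h)
  orbit : ∀ p p', toBase p = toBase p' ↔ ∃ a : A, p' = bundle.act p (E.incl a)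
  subduction : IsSubductionOnto toBase {p | P.proj p ∈ U}

namespace LocalLift

variable {P : PrincipalBundle E.H (⊤ : Opens X)} {U V : Opens X}

/-- Morphisms of lifts: isomorphisms of `Ĥ`-bundles compatible with the projections to `P`. -/
@[ext]
structure Hom (L M : LocalLift P U) where
  toEquiv : L.bundle.Total ≃ M.bundle.Total
  smooth : DSmooth toEquiv
  smooth_symm : DSmooth toEquiv.symm
  map_act : ∀ p h, toEquiv (L.bundle.act p h) = M.bundle.act (toEquiv p) h
  toBase_map : ∀ p, M.toBase (toEquiv p) = L.toBase p

instance : Groupoid (LocalLift P U) where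
  Hom := Hom
  id L := ⟨Equiv.refl _, dSmooth_id, dSmooth_id, fun _ _ ↦ rfl, fun _ ↦ rfl⟩
  comp f g := ⟨f.toEquiv.trans g.toEquiv, g.smooth.comp f.smooth,
    f.smooth_symm.comp g.smooth_symm, fun p h ↦ by simp [f.map_act, g.map_act],
    fun p ↦ by simp [f.toBase_map, g.toBase_map]⟩
  inv {L M} f := ⟨f.toEquiv.symm, f.smooth_symm, f.smooth,
    fun p h ↦ by rw [Equiv.symm_apply_eq, f.map_act, Equiv.apply_symm_apply],
    fun p ↦ by rw [← f.toBase_map, Equiv.apply_symm_apply]⟩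
  inv_comp f := Hom.ext (Equiv.symm_trans_self _)
  comp_inv f := Hom.ext (Equiv.self_trans_symm _)

/-- Restriction of lifts. -/
def restrict (L : LocalLift P U) (h : V ≤ U) : LocalLift P V where
  bundle := L.bundle.restrict h
  toBase p := L.toBase p.1
  proj_toBase p := L.proj_toBase p.1
  toBase_act p k := L.toBase_act p.1 k
  orbit p p' := (L.orbit p.1 p'.1).trans
    ⟨fun ⟨a, ha⟩ ↦ ⟨a, Subtype.ext ha⟩, fun ⟨a, ha⟩ ↦ ⟨a, congrArg Subtype.val ha⟩⟩
  subduction := by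
    refine ⟨fun n p hp ↦ L.subduction.1 n _ hp, fun p ↦ ?_, fun n p hp hV t ↦ ?_⟩
    · rw [Set.mem_ofPred_eq, L.proj_toBase]
      exact p.2
    · obtain ⟨O, hO, ht, p', hp', h'⟩ := L.subduction.2.2 n p hp (fun t ↦ h (hV t)) t
      obtain ⟨φ, hφ, hφO, W, hW, htW, hφW⟩ := exists_smooth_retract hO ht
      refine ⟨W, hW, htW, fun s ↦ ⟨p' (φ s), ?_⟩, isPlot_reparam hp' hφ, fun s hs ↦ ?_⟩
      · rw [← L.proj_toBase, h' _ (hφO s)]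
        exact hV _
      · change L.toBase (p' (φ s)) = p s
        rw [hφW s hs, h' s (by rw [← hφW s hs]; exact hφO s)]

/-- Restriction of morphisms of lifts. -/
def Hom.restrict {L M : LocalLift P U} (f : Hom L M) (h : V ≤ U) :
    Hom (L.restrict h) (M.restrict h) where
  toEquiv := f.toEquiv.subtypeEquiv fun p ↦ by
    rw [← M.proj_toBase, f.toBase_map, L.proj_toBase]
  smooth n p hp := f.smooth n _ hp
  smooth_symm n p hp := f.smooth_symm n _ hp
  map_act p k := Subtype.ext (f.map_act p.1 k)
  toBase_map p := f.toBase_map p.1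

/-- The restriction functors. -/
def restrictFunctor (P : PrincipalBundle E.H (⊤ : Opens X)) (h : V ≤ U) :
    LocalLift P U ⥤ LocalLift P V where
  obj L := L.restrict h
  map f := Hom.restrict f h

/-- The canonical isomorphism `P̂|_U ≅ P̂`. -/
def restrictId (P : PrincipalBundle E.H (⊤ : Opens X)) (U : Opens X) :
    restrictFunctor P (le_refl U) ≅ 𝟭 (LocalLift P U) :=
  NatIso.ofComponents (fun L ↦ (Groupoid.isoEquivHom _ _).symm
    { toEquiv := Equiv.subtypeUnivEquiv L.bundle.proj_mem
      smooth := fun n p hp ↦ hp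
      smooth_symm := fun n p hp ↦ hp
      map_act := fun _ _ ↦ rfl
      toBase_map := fun _ ↦ rfl }) fun f ↦ rfl

/-- The canonical isomorphism `P̂|_W ≅ (P̂|_V)|_W`. -/
def restrictComp (P : PrincipalBundle E.H (⊤ : Opens X)) {U V W : Opens X} (h : V ≤ U)
    (k : W ≤ V) :
    restrictFunctor P (k.trans h) ≅ restrictFunctor P h ⋙ restrictFunctor P k :=
  NatIso.ofComponents (fun L ↦ (Groupoid.isoEquivHom _ _).symm
    { toEquiv :=
        { toFun := fun p ↦ ⟨⟨p.1, k p.2⟩, p.2⟩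
          invFun := fun p ↦ ⟨p.1.1, p.2⟩
          left_inv := fun _ ↦ rfl
          right_inv := fun _ ↦ rfl }
      smooth := fun n p hp ↦ hp
      smooth_symm := fun n p hp ↦ hp
      map_act := fun _ _ ↦ rfl
      toBase_map := fun _ ↦ rfl }) fun f ↦ rfl

end LocalLift

/-- The lifting gerbe `𝒢(P, Ĥ)`: the groupoids of lifts of `P` over the open subsets of `X`, with
their restriction functors. -/
def liftingGerbe (P : PrincipalBundle E.H (⊤ : Opens X)) :
    Pseudofunctor (LocallyDiscrete (Opens X)ᵒᵖ) Cat.{u, u + 1} :=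
  LocallyDiscrete.mkPseudofunctor
    (fun U ↦ Cat.of (LocalLift P U.unop))
    (fun f ↦ (LocalLift.restrictFunctor P f.unop.le).toCatHom)
    (fun U ↦ Cat.Hom.isoMk (LocalLift.restrictId P U.unop))
    (fun f g ↦ Cat.Hom.isoMk (LocalLift.restrictComp P f.unop.le g.unop.le))
    (fun f g h ↦ by
      ext1
      ext L
      refine LocalLift.Hom.ext (Equiv.ext fun p ↦ ?_)
      rfl)
    (fun f ↦ by
      ext1
      ext L
      refine LocalLift.Hom.ext (Equiv.ext fun p ↦ ?_)
      rfl)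
    (fun f ↦ by
      ext1
      ext L
      refine LocalLift.Hom.ext (Equiv.ext fun p ↦ ?_)
      rfl)

/-- The canonical action of sections of `A_α` on lifts, by fibrewise multiplication: on the points of
`P̂` above the local section `s i` of `P`, a section `a` of `A_α` acts as right multiplication by its
`i`-th component. -/
def IsCanonicalBanding [DiffeologicalGroup A] {P : PrincipalBundle E.H (⊤ : Opens X)}
    (T : Trivialization P) (θ : Banding (liftingGerbe P) (localSystem E T.twist)) : Prop :=
  ∀ (U : Opens X) (L : LocalLift P U) (a : (localSystem E T.twist).obj (op U)) (i : T.cover.idx)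
    (p : L.bundle.Total) (hi : L.bundle.proj p ∈ T.cover.set i),
    L.toBase p = T.s i ⟨L.bundle.proj p, hi⟩ →
      LocalLift.Hom.toEquiv (L := L) (M := L) (θ.iso (U := U) L a).hom p =
        L.bundle.act p (E.incl (component a i (L.bundle.proj p) (L.bundle.proj_mem p) hi))

/-- `c` is the obstruction cochain `a_ijk = ĝ_ij · σhat^{ε_ij}(ĝ_jk) · ĝ_ik⁻¹` of the lifts `ĝ_ij`:
`c_ijk`, a section of `A_α` over `U_ijk`, has this function as its component in the `i`-th frame. -/
def IsObstructionCochain [DiffeologicalGroup A] {P : PrincipalBundle E.H (⊤ : Opens X)}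
    (T : Trivialization P) (l : T.Lifts) (c : T.cover.C2 (localSystem E T.twist)) : Prop :=
  ∀ (i j k : T.cover.idx) (x : X) (hi : x ∈ T.cover.set i) (hj : x ∈ T.cover.set j)
    (hk : x ∈ T.cover.set k),
    E.ι (component (c i j k) i x ⟨⟨hi, hj⟩, hk⟩ hi) =
      l.g i j ⟨x, hi, hj⟩ * E.σhat (T.ε i j ⟨x, hi, hj⟩) (l.g j k ⟨x, hj, hk⟩) *
        (l.g i k ⟨x, hi, hk⟩)⁻¹

end Lifting

end DiffGerbe

end

set_option linter.unusedSectionVars false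

noncomputable section

namespace DiffGerbe

/-! ### Smooth maps -/

section Smooth

variable {X Y Z W : Type*} [DiffeologicalSpace X] [DiffeologicalSpace Y] [DiffeologicalSpace Z]
  [DiffeologicalSpace W]

/-! Gerbe. Over an open set where `P` has a section `s`, the product with `Ĥ` and the map `(x, h) ↦
s x · π h` form a lift, so lifts exist locally. Given local sections of two lifts, their images in
`P` differ by a smooth `H`-valued function. A local lift of its `G`-component through `q` corrects
one section until both lie above the same section of `P`, and matching sections determine an
isomorphism (`exists_hom_of_sections`). This is where `LiftsLocallyOn` enters. The coherence
isomorphisms of the pseudofunctor do not move points of total spaces, so a descent datum is a family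
of transition maps satisfying the cocycle identities on points. Effectivity amounts to putting a
suitable diffeology on the quotient (`GluingData`).

Band. An automorphism of a lift moves each point `p` inside its `A`-orbit, by some `c p : A`. The
subgroup `A` is central in `Ĝ` but not in `Ĥ`: conjugation by `Ĥ` acts on it through `ℤ₂`
(`incl_mul_eq`). Equivariance therefore says that `c` descends to a function on `P` with `c (p · k)
= k.right⁻¹ · c p`. Restricting such a function to the sections `s i` gives exactly a section of
`A_α`, and `value` rebuilds the function from its restrictions.

Class. For any banded gerbe, the cochain of a choice of local objects and isomorphisms is a cocycle
(`HasCochain.mem_Z2`), and two choices give cohomologous cochains (`HasCochain.cechRel`). One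
computation is then enough: take the trivial lifts over the `U_i` and the isomorphisms that send the
frame `j` to the frame `i` times `ĥ_ij = (ĝ_ij, ε_ij)`. The twisted expression for `a_ijk` is the
defect of `ĥ_ij ĥ_jk = ĥ_ik` in the semidirect product. Its cocycle identity needs no separate
calculation, being inherited from the gerbe. -/

lemma isPlot_of_eventually_eq {n : ℕ} {p : EuclideanSpace ℝ (Fin n) → Y}
    (h : ∀ t, ∃ O : Set (EuclideanSpace ℝ (Fin n)), IsOpen O ∧ t ∈ O ∧
      ∃ p' : EuclideanSpace ℝ (Fin n) → Y, IsPlot p' ∧ ∀ s ∈ O, p s = p' s) : IsPlot p := by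
  refine DiffeologicalSpace.locality fun t ↦ ?_
  obtain ⟨O, hO, ht, p', hp', he⟩ := h t
  refine ⟨O, hO, ht, fun {m f} hf hf' ↦ ?_⟩
  have : p ∘ f = p' ∘ f := funext fun s ↦ he _ (hf s)
  rw [this]
  exact isPlot_reparam hp' hf'

/-- This is the defining property of the D-topology. It turns open covers of `X` into open covers of
the domains of plots, where the locality axiom applies. -/
lemma isOpen_preimage_of_isPlot {X : Type*} [TopologicalSpace X] [DiffeologicalSpace X]
    [IsDTopologyCompatible X] (V : Opens X) {n : ℕ} {p : EuclideanSpace ℝ (Fin n) → X}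
    (hp : IsPlot p) : IsOpen {t | p t ∈ V} := by
  refine isOpen_iff_preimages_plots.1 ?_ n p hp
  rw [IsDTopologyCompatible.dTop_eq X]
  exact V.isOpen

/-- Smoothness is local with respect to a smooth map to a space with the D-topology. -/
lemma dSmooth_of_local {X : Type*} [TopologicalSpace X] [DiffeologicalSpace X]
    [IsDTopologyCompatible X] {π : Y → X} (hπ : DSmooth π) {f : Y → Z}
    (h : ∀ y, ∃ V : Opens X, π y ∈ V ∧ DSmooth (fun z : {z // π z ∈ V} ↦ f z.1)) : DSmooth f := by
  intro n p hp
  refine DiffeologicalSpace.locality fun t ↦ ?_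
  obtain ⟨V, hV, hf⟩ := h (p t)
  exact ⟨_, isOpen_preimage_of_isPlot V (hπ n p hp), hV, fun {m φ} hφ hφ' ↦
    hf m (fun s ↦ ⟨p (φ s), hφ s⟩) (isPlot_reparam hp hφ')⟩

lemma dSmooth_val {p : X → Prop} : DSmooth (Subtype.val : {x // p x} → X) := fun _ _ h ↦ h

lemma dSmooth_subtypeMk {p : X → Prop} {f : Y → X} (hf : DSmooth f) (h : ∀ y, p (f y)) :
    DSmooth (fun y ↦ (⟨f y, h y⟩ : {x // p x})) := fun n q hq ↦ hf n q hq

lemma dSmooth_fst : DSmooth (Prod.fst : X × Y → X) := fun _ _ h ↦ h.1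

lemma dSmooth_snd : DSmooth (Prod.snd : X × Y → Y) := fun _ _ h ↦ h.2

lemma dSmooth_prodMk {f : X → Y} {g : X → Z} (hf : DSmooth f) (hg : DSmooth g) :
    DSmooth (fun x ↦ (f x, g x)) := fun n p hp ↦ ⟨hf n p hp, hg n p hp⟩

lemma dSmooth_mul {G : Type*} [Group G] [DiffeologicalSpace G] [DiffeologicalGroup G]
    {f g : X → G} (hf : DSmooth f) (hg : DSmooth g) : DSmooth (fun x ↦ f x * g x) :=
  DiffeologicalGroup.smooth_mul.comp (dSmooth_prodMk hf hg)

lemma dSmooth_inv {G : Type*} [Group G] [DiffeologicalSpace G] [DiffeologicalGroup G]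
    {f : X → G} (hf : DSmooth f) : DSmooth (fun x ↦ (f x)⁻¹) :=
  DiffeologicalGroup.smooth_inv.comp hf

/-- A map from a product with `ℤˣ` is smooth as soon as its partial maps are. -/
lemma dSmooth_uncurry_units {f : ℤˣ → X → Y} (hf : ∀ ε, DSmooth (f ε)) {e : Z → ℤˣ} {g : Z → X}
    (he : DSmooth e) (hg : DSmooth g) : DSmooth (fun z ↦ f (e z) (g z)) := by
  intro n p hp
  have hc : ∀ s t, e (p s) = e (p t) := he n p hp
  have : (fun z ↦ f (e z) (g z)) ∘ p = f (e (p 0)) ∘ g ∘ p :=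
    funext fun t ↦ by simp [hc t 0]
  rw [this]
  exact hf _ _ _ (hg n p hp)

lemma dSmooth_units_of {f : ℤˣ → Y} : DSmooth f := fun n p hp ↦ by
  have : f ∘ p = fun _ ↦ f (p 0) := funext fun t ↦ congrArg f (hp t 0)
  rw [this]
  exact isPlot_const

instance : DiffeologicalGroup ℤˣ where
  smooth_mul _ _ hp s t := congrArg₂ (· * ·) (hp.1 s t) (hp.2 s t)
  smooth_inv := dSmooth_units_of

variable {N : Type*} [Group N] [DiffeologicalSpace N] {φ : ℤˣ →* MulAut N}

lemma dSmooth_left {K : Type*} [Group K] [DiffeologicalSpace K] {φ : K →* MulAut N} :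
    DSmooth (SemidirectProduct.left : N ⋊[φ] K → N) := fun _ _ h ↦ h.1

lemma dSmooth_right {K : Type*} [Group K] [DiffeologicalSpace K] {φ : K →* MulAut N} :
    DSmooth (SemidirectProduct.right : N ⋊[φ] K → K) := fun _ _ h ↦ h.2

lemma dSmooth_semidirectMk {K : Type*} [Group K] [DiffeologicalSpace K] {φ : K →* MulAut N}
    {f : X → N} {g : X → K} (hf : DSmooth f) (hg : DSmooth g) :
    DSmooth (fun x ↦ (⟨f x, g x⟩ : N ⋊[φ] K)) := fun n p hp ↦ ⟨hf n p hp, hg n p hp⟩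

lemma diffeologicalGroup_semidirect [DiffeologicalGroup N] (h : ∀ ε, DSmooth (φ ε)) :
    DiffeologicalGroup (N ⋊[φ] ℤˣ) where
  smooth_mul := dSmooth_semidirectMk
    (dSmooth_mul (dSmooth_left.comp dSmooth_fst)
      (dSmooth_uncurry_units (f := fun ε x ↦ φ ε x) h (dSmooth_right.comp dSmooth_fst)
        (dSmooth_left.comp dSmooth_snd)))
    (dSmooth_mul (dSmooth_right.comp dSmooth_fst) (dSmooth_right.comp dSmooth_snd))
  smooth_inv := dSmooth_semidirectMk
    (dSmooth_uncurry_units (f := fun ε x ↦ φ ε x) h (dSmooth_inv dSmooth_right)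
      (dSmooth_inv dSmooth_left))
    (dSmooth_inv dSmooth_right)

end Smooth

/-! ### Consequences of exactness and centrality; the action of `ℤ₂` on `A` -/

namespace TwistedCentralExtension

variable {A Ghat G : Type u} [CommGroup A] [Group Ghat] [Group G]
    [DiffeologicalSpace A] [DiffeologicalSpace Ghat] [DiffeologicalSpace G]
    (E : TwistedCentralExtension A Ghat G)

instance [DiffeologicalGroup G] : DiffeologicalGroup E.H := diffeologicalGroup_semidirect E.smooth_σ

instance [DiffeologicalGroup Ghat] : DiffeologicalGroup E.Hhat :=
  diffeologicalGroup_semidirect E.smooth_σhat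

lemma smooth_ι : DSmooth E.ι := fun n p hp ↦ (E.ι_induction n p).1 hp

lemma smooth_of_ι {Y : Type*} [DiffeologicalSpace Y] {f : Y → A}
    (h : DSmooth (fun y ↦ E.ι (f y))) : DSmooth f :=
  fun n p hp ↦ (E.ι_induction n _).2 (h n p hp)

lemma smooth_π : DSmooth E.π :=
  dSmooth_semidirectMk (E.q_subduction.1.comp dSmooth_left) dSmooth_right

lemma incl_injective : Function.Injective E.incl :=
  SemidirectProduct.inl_injective.comp E.ι_injective

lemma smooth_incl : DSmooth E.incl := dSmooth_semidirectMk E.smooth_ι dSmooth_const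

lemma smooth_of_incl {Y : Type*} [DiffeologicalSpace Y] {f : Y → A}
    (h : DSmooth (fun y ↦ E.incl (f y))) : DSmooth f :=
  E.smooth_of_ι (dSmooth_left.comp h)

lemma q_ι (a : A) : E.q (E.ι a) = 1 := by
  have : E.ι a ∈ E.q.ker := E.exact ▸ ⟨a, rfl⟩
  exact this

lemma exists_ι_of_q {g : Ghat} (h : E.q g = 1) : ∃ a, E.ι a = g := by
  have : g ∈ E.ι.range := E.exact ▸ h
  exact this

lemma q_surjective : Function.Surjective E.q := fun g ↦ by
  -- A point is a plot of dimension `0`, and its local lift at the origin is a preimage.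
  obtain ⟨O, -, h0, p, -, hp⟩ := E.q_subduction.2.2 0 (fun _ ↦ g) isPlot_const (fun _ ↦ trivial) 0
  exact ⟨_, hp 0 h0⟩

@[simp]
lemma π_mk (g : Ghat) (ε : ℤˣ) : E.π ⟨g, ε⟩ = ⟨E.q g, ε⟩ := rfl

lemma π_surjective : Function.Surjective E.π := fun ⟨g, ε⟩ ↦ by
  obtain ⟨g', rfl⟩ := E.q_surjective g
  exact ⟨⟨g', ε⟩, rfl⟩

@[simp]
lemma π_incl (a : A) : E.π (E.incl a) = 1 := SemidirectProduct.ext (E.q_ι a) rfl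

lemma exists_incl_of_π {h : E.Hhat} (hh : E.π h = 1) : ∃ a, E.incl a = h := by
  obtain ⟨a, ha⟩ := E.exists_ι_of_q (g := h.left) (congrArg SemidirectProduct.left hh)
  exact ⟨a, SemidirectProduct.ext ha (congrArg SemidirectProduct.right hh).symm⟩

/-- The action of `ℤ₂` on `A ⊆ Ĝ`. -/
def actA (ε : ℤˣ) (a : A) : A :=
  (E.exists_ι_of_q (g := E.σhat ε (E.ι a)) (by rw [E.q_σhat, E.q_ι, map_one])).choose

lemma ι_actA (ε : ℤˣ) (a : A) : E.ι (E.actA ε a) = E.σhat ε (E.ι a) :=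
  (E.exists_ι_of_q (g := E.σhat ε (E.ι a)) (by rw [E.q_σhat, E.q_ι, map_one])).choose_spec

lemma actA_one_left (a : A) : E.actA 1 a = a := E.ι_injective (by simp [ι_actA])

lemma actA_mul_left (ε δ : ℤˣ) (a : A) : E.actA (ε * δ) a = E.actA ε (E.actA δ a) :=
  E.ι_injective (by simp [ι_actA])

lemma actA_mul_right (ε : ℤˣ) (a b : A) : E.actA ε (a * b) = E.actA ε a * E.actA ε b :=
  E.ι_injective (by simp [ι_actA])

lemma smooth_actA {Y : Type*} [DiffeologicalSpace Y] {e : Y → ℤˣ} {f : Y → A} (he : DSmooth e)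
    (hf : DSmooth f) : DSmooth (fun y ↦ E.actA (e y) (f y)) := by
  refine E.smooth_of_ι ?_
  simp only [ι_actA]
  exact dSmooth_uncurry_units (f := fun ε x ↦ E.σhat ε x) E.smooth_σhat he (E.smooth_ι.comp hf)

lemma ι_comm (a : A) (g : Ghat) : E.ι a * g = g * E.ι a :=
  ((Subgroup.mem_center_iff.1 (E.central ⟨a, rfl⟩)) g).symm

/-- The `Ĝ`-part of `h` commutes with `A`, so only its sign acts. This identity is the source of the
twist: it makes the band `A_α` instead of the constant sheaf of `A`-valued functions. -/
lemma incl_mul_eq (a : A) (h : E.Hhat) :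
    E.incl a * h = h * E.incl (E.actA h.right⁻¹ a) := by
  refine SemidirectProduct.ext ?_ ?_
  · change E.ι a * E.σhat 1 h.left = h.left * E.σhat h.right (E.ι (E.actA h.right⁻¹ a))
    rw [map_one, MulAut.one_apply, ι_actA, ← MulAut.mul_apply, ← map_mul, mul_inv_cancel, map_one,
      MulAut.one_apply, ι_comm]
  · simp [incl]

end TwistedCentralExtension

/-! ### Principal bundles -/

namespace PrincipalBundle

variable {X : Type u} [TopologicalSpace X] [DiffeologicalSpace X]
  {H : Type u} [Group H] [DiffeologicalSpace H] {U : Opens X} (P : PrincipalBundle H U)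

lemma exists_act_eq {p p' : P.Total} (h : P.proj p = P.proj p') : ∃ k, p' = P.act p k := by
  obtain ⟨V, hx, -, e, -, -, he, he'⟩ := P.locally_trivial (P.proj p) (P.proj_mem p)
  obtain ⟨⟨x, l⟩, hz⟩ := e.surjective ⟨p, hx⟩
  obtain ⟨⟨x', l'⟩, hz'⟩ := e.surjective ⟨p', by rw [← h]; exact hx⟩
  have hp : p = (e (x, l)).1 := by rw [hz]
  have hp' : p' = (e (x', l')).1 := by rw [hz']
  have hxx : x = x' := Subtype.ext (by rw [hp, hp', he, he] at h; exact h)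
  refine ⟨l⁻¹ * l', ?_⟩
  rw [hp, hp', ← he', mul_inv_cancel_left, hxx]

lemma act_inv_act (p : P.Total) (h : H) : P.act (P.act p h) h⁻¹ = p := by
  rw [← P.act_mul, mul_inv_cancel, P.act_one]

lemma dSmooth_act {Y : Type*} [DiffeologicalSpace Y] {f : Y → P.Total} {k : Y → H}
    (hf : DSmooth f) (hk : DSmooth k) : DSmooth (fun y ↦ P.act (f y) (k y)) :=
  P.smooth_act.comp (dSmooth_prodMk hf hk)

lemma exists_section {x : X} (hx : x ∈ U) : ∃ (V : Opens X) (_ : V ≤ U), x ∈ V ∧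
    ∃ s : V → P.Total, DSmooth s ∧ ∀ y, P.proj (s y) = y.1 := by
  obtain ⟨V, hxV, hV, e, he, -, he', -⟩ := P.locally_trivial x hx
  exact ⟨V, hV, hxV, fun y ↦ (e (y, 1)).1,
    dSmooth_val.comp (he.comp (dSmooth_prodMk dSmooth_id dSmooth_const)), fun y ↦ he' _⟩

/-- The division map of a principal bundle is smooth. -/
lemma dSmooth_of_act_eq [IsDTopologyCompatible X] [DiffeologicalGroup H]
    {Y : Type*} [DiffeologicalSpace Y] {a b : Y → P.Total} {k : Y → H}
    (ha : DSmooth a) (hb : DSmooth b) (h : ∀ y, b y = P.act (a y) (k y)) : DSmooth k := by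
  refine dSmooth_of_local (P.smooth_proj.comp ha) fun y ↦ ?_
  obtain ⟨V, hx, -, e, -, hs, -, he⟩ := P.locally_trivial (P.proj (a y)) (P.proj_mem _)
  refine ⟨V, hx, ?_⟩
  have hbV : ∀ z : {z // P.proj (a z) ∈ V}, P.proj (b z.1) ∈ V := fun z ↦ by
    rw [h, P.proj_act]; exact z.2
  -- In a local trivialization, `k` is the quotient of the fibre coordinates of `a` and `b`, hence
  -- smooth.
  have key : ∀ z : {z // P.proj (a z) ∈ V},
      k z.1 = (e.symm ⟨a z.1, z.2⟩).2⁻¹ * (e.symm ⟨b z.1, hbV z⟩).2 := fun z ↦ by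
    obtain ⟨⟨x, l⟩, hz⟩ := e.surjective ⟨a z.1, z.2⟩
    have hb' : (⟨b z.1, hbV z⟩ : {p // P.proj p ∈ V}) = e (x, l * k z.1) :=
      Subtype.ext (by rw [he, hz]; exact h _)
    rw [hb', ← hz]
    simp
  change DSmooth fun z : {z // P.proj (a z) ∈ V} ↦ k z.1
  rw [funext key]
  exact dSmooth_mul
    (dSmooth_inv (dSmooth_snd.comp (hs.comp (dSmooth_subtypeMk (ha.comp dSmooth_val) _))))
    (dSmooth_snd.comp (hs.comp (dSmooth_subtypeMk (hb.comp dSmooth_val) _)))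

end PrincipalBundle

namespace LocalLift

variable {X : Type u} [TopologicalSpace X] [DiffeologicalSpace X]
  {A Ghat G : Type u} [CommGroup A] [Group Ghat] [Group G]
  [DiffeologicalSpace A] [DiffeologicalSpace Ghat] [DiffeologicalSpace G]
  {E : TwistedCentralExtension A Ghat G} {P : PrincipalBundle E.H (⊤ : Opens X)} {U V : Opens X}

/-! ### Morphisms of lifts -/

/-- The map of total spaces underlying a morphism of lifts. -/
def ev {L M : LocalLift P U} (f : L ⟶ M) (p : L.bundle.Total) : M.bundle.Total :=
  Hom.toEquiv f p

section ev

variable {L M N : LocalLift P U}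

lemma hom_ext {f g : L ⟶ M} (h : ∀ p, ev f p = ev g p) : f = g := Hom.ext (Equiv.ext h)

lemma ev_act (f : L ⟶ M) (p : L.bundle.Total) (h : E.Hhat) :
    ev f (L.bundle.act p h) = M.bundle.act (ev f p) h := Hom.map_act f p h

lemma toBase_ev (f : L ⟶ M) (p : L.bundle.Total) : M.toBase (ev f p) = L.toBase p :=
  Hom.toBase_map f p

lemma proj_ev (f : L ⟶ M) (p : L.bundle.Total) : M.bundle.proj (ev f p) = L.bundle.proj p := by
  rw [← proj_toBase, toBase_ev, proj_toBase]

lemma smooth_ev (f : L ⟶ M) : DSmooth (ev f) := Hom.smooth f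

lemma ev_comp (f : L ⟶ M) (g : M ⟶ N) (p : L.bundle.Total) : ev (f ≫ g) p = ev g (ev f p) := rfl

lemma toBase_surjective (L : LocalLift P U) {p : P.Total} (hp : P.proj p ∈ U) :
    ∃ p', L.toBase p' = p := by
  obtain ⟨O, -, h0, p', -, h⟩ := L.subduction.2.2 0 (fun _ ↦ p) isPlot_const (fun _ ↦ hp) 0
  exact ⟨_, h 0 h0⟩

lemma toBase_act_incl (L : LocalLift P U) (p : L.bundle.Total) (a : A) :
    L.toBase (L.bundle.act p (E.incl a)) = L.toBase p := ((L.orbit _ _).2 ⟨a, rfl⟩).symm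

/-- Two morphisms which agree at some point over every point of the base are equal. -/
lemma hom_ext_of_section {f g : L ⟶ M}
    (h : ∀ x ∈ U, ∃ p, L.bundle.proj p = x ∧ ev f p = ev g p) : f = g := by
  refine hom_ext fun p ↦ ?_
  obtain ⟨p', hp', h'⟩ := h _ (L.bundle.proj_mem p)
  obtain ⟨k, rfl⟩ := L.bundle.exists_act_eq hp'
  rw [ev_act, ev_act, h']

end ev

variable [IsDTopologyCompatible X] [DiffeologicalGroup Ghat]

/-- Smooth equivariant maps of lifts which are compatible with the projections to `P` are
isomorphisms. -/
theorem exists_hom_of_map {L M : LocalLift P U} (f : L.bundle.Total → M.bundle.Total)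
    (hf : DSmooth f) (map_act : ∀ p h, f (L.bundle.act p h) = M.bundle.act (f p) h)
    (toBase_map : ∀ p, M.toBase (f p) = L.toBase p) : ∃ F : L ⟶ M, ∀ p, ev F p = f p := by
  have hbij : Function.Bijective f := by
    constructor
    · intro p p' h
      have hb := congrArg M.toBase h
      rw [toBase_map, toBase_map] at hb
      obtain ⟨a, rfl⟩ := (L.orbit _ _).1 hb
      rw [map_act] at h
      have : (1 : E.Hhat) = E.incl a := M.bundle.act_free ((M.bundle.act_one _).trans h)
      rw [← this, L.bundle.act_one]
    · intro m
      have hm : P.proj (M.toBase m) ∈ U := by rw [proj_toBase]; exact M.bundle.proj_mem m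
      obtain ⟨p, hp⟩ := L.toBase_surjective hm
      obtain ⟨a, ha⟩ := (M.orbit (f p) m).1 (by rw [toBase_map, hp])
      exact ⟨L.bundle.act p (E.incl a), by rw [map_act, ha]⟩
  let e := Equiv.ofBijective f hbij
  have he : ∀ p, e p = f p := fun _ ↦ rfl
  refine ⟨⟨e, hf, ?_, map_act, toBase_map⟩, fun _ ↦ rfl⟩
  -- Smoothness of the inverse: a plot `m` of `M` is projected to `P` and lifted locally to a plot
  -- `p` of `L`. Then `f ∘ p` and `m` lie in the same `A`-orbits, and the element of `A` relating
  -- them is smooth by division. Moving `p` by it gives the inverse image of `m`.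
  intro n m hm
  refine isPlot_of_eventually_eq fun t ↦ ?_
  obtain ⟨O, hO, ht, p, hp, hpm⟩ := L.subduction.2.2 n (M.toBase ∘ m) (M.subduction.1 n m hm)
    (fun t ↦ by
      change P.proj (M.toBase (m t)) ∈ U
      rw [proj_toBase]; exact M.bundle.proj_mem _) t
  -- Plots live on all of `ℝⁿ`, while `p` lifts the given plot only on `O`. Precomposing with `φ`
  -- makes the relation hold everywhere without changing anything near `t`.
  obtain ⟨φ, hφ, hφO, W, hW, htW, hφW⟩ := exists_smooth_retract hO ht
  have hex : ∀ s, ∃ a : A, m (φ s) = M.bundle.act (f (p (φ s))) (E.incl a) := fun s ↦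
    (M.orbit _ _).1 (by rw [toBase_map, hpm _ (hφO s)]; rfl)
  choose a ha using hex
  have hpφ : DSmooth (fun s ↦ p (φ s)) := (isPlot_reparam hp hφ).dSmooth
  have hs : DSmooth (fun s ↦ E.incl (a s)) := M.bundle.dSmooth_of_act_eq
    (hf.comp hpφ) (isPlot_reparam hm hφ).dSmooth ha
  refine ⟨W, hW, htW, fun s ↦ L.bundle.act (p (φ s)) (E.incl (a s)),
    (L.bundle.dSmooth_act hpφ hs).isPlot, fun s hsW ↦ ?_⟩
  change e.symm (m s) = _
  rw [Equiv.symm_apply_eq, he, map_act, ← ha, hφW s hsW]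

/-- Smooth sections of two lifts above the same section of `P` determine an isomorphism. -/
theorem exists_hom_of_sections {L M : LocalLift P U} (s : U → L.bundle.Total)
    (t : U → M.bundle.Total) (hs : DSmooth s) (ht : DSmooth t)
    (hps : ∀ x, L.bundle.proj (s x) = x.1) (h : ∀ x, L.toBase (s x) = M.toBase (t x)) :
    ∃ F : L ⟶ M, ∀ x, ev F (s x) = t x := by
  let β : L.bundle.Total → U := fun p ↦ ⟨L.bundle.proj p, L.bundle.proj_mem p⟩
  have hβ : DSmooth β := dSmooth_subtypeMk L.bundle.smooth_proj _
  have hk : ∀ p, ∃ k, p = L.bundle.act (s (β p)) k :=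
    fun p ↦ L.bundle.exists_act_eq (hps _)
  choose k hk using hk
  have hsk : DSmooth k := L.bundle.dSmooth_of_act_eq (hs.comp hβ) dSmooth_id hk
  have hβa : ∀ p h, β (L.bundle.act p h) = β p := fun p h ↦ Subtype.ext (L.bundle.proj_act p h)
  obtain ⟨F, hF⟩ := exists_hom_of_map (L := L) (M := M) (fun p ↦ M.bundle.act (t (β p)) (k p))
    (M.bundle.dSmooth_act (ht.comp hβ) hsk) (fun p h ↦ by
      have : k (L.bundle.act p h) = k p * h := by
        refine L.bundle.act_free (p := s (β p)) ?_
        rw [L.bundle.act_mul, ← hk p, ← hβa p h, ← hk]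
      rw [this, hβa, M.bundle.act_mul]) (fun p ↦ by
      rw [toBase_act, ← h, ← toBase_act, ← hk])
  refine ⟨F, fun x ↦ ?_⟩
  have hx : β (s x) = x := Subtype.ext (hps x)
  have : k (s x) = 1 := L.bundle.act_free (p := s x) (by
    rw [L.bundle.act_one]; conv_rhs => rw [hk (s x), hx])
  rw [hF, hx, this, M.bundle.act_one]

/-- Lifts of `P` are locally isomorphic. -/
theorem locally_connected [DiffeologicalGroup G] (hE : E.LiftsLocallyOn X) (L M : LocalLift P U)
    {x : X} (hx : x ∈ U) :
    ∃ (V : Opens X) (h : V ≤ U), x ∈ V ∧ Nonempty (L.restrict h ⟶ M.restrict h) := by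
  obtain ⟨V₁, hV₁, hx₁, s, hs, hps⟩ := L.bundle.exists_section hx
  obtain ⟨V₂, hV₂, hx₂, t, ht, hpt⟩ := M.bundle.exists_section hx
  let s' : ↥(V₁ ⊓ V₂) → L.bundle.Total := fun y ↦ s ⟨y.1, y.2.1⟩
  let t' : ↥(V₁ ⊓ V₂) → M.bundle.Total := fun y ↦ t ⟨y.1, y.2.2⟩
  have hs' : DSmooth s' := hs.comp (dSmooth_subtypeMk dSmooth_val _)
  have ht' : DSmooth t' := ht.comp (dSmooth_subtypeMk dSmooth_val _)
  have hk : ∀ y, ∃ k, M.toBase (t' y) = P.act (L.toBase (s' y)) k := fun y ↦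
    P.exists_act_eq (by rw [proj_toBase, proj_toBase]; exact (hps _).trans (hpt ⟨y.1, y.2.2⟩).symm)
  choose k hk using hk
  have hks : DSmooth k :=
    P.dSmooth_of_act_eq (L.subduction.1.comp hs') (M.subduction.1.comp ht') hk
  -- Only the `G`-component of `k` has to be lifted, since the sign is already a component of `Ĥ`.
  -- With this lift, `s' · (g, k.right)` and `t'` have the same image in `P`.
  obtain ⟨V, hV, hxV, g, hg, hgk⟩ := hE _ _ (dSmooth_left.comp hks) ⟨x, hx₁, hx₂⟩
  have hVU : V ≤ U := fun y hy ↦ hV₁ (hV hy).1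
  refine ⟨V, hVU, hxV, ?_⟩
  let j : V → ↥(V₁ ⊓ V₂) := fun y ↦ ⟨y.1, hV y.2⟩
  have hj : DSmooth j := dSmooth_subtypeMk dSmooth_val _
  let σ : V → L.bundle.Total := fun y ↦ L.bundle.act (s' (j y)) ⟨g y, (k (j y)).right⟩
  have hσp : ∀ y, L.bundle.proj (σ y) = y.1 := fun y ↦ by
    rw [L.bundle.proj_act]; exact hps _
  have hσ : DSmooth σ := L.bundle.dSmooth_act (hs'.comp hj)
    (dSmooth_semidirectMk hg (dSmooth_right.comp (hks.comp hj)))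
  have hσV : ∀ y : V, L.bundle.proj (σ y) ∈ V := fun y ↦ by rw [hσp]; exact y.2
  have htV : ∀ y : V, M.bundle.proj (t' (j y)) ∈ V := fun y ↦ by rw [hpt]; exact y.2
  obtain ⟨F, -⟩ := exists_hom_of_sections (L := L.restrict hVU) (M := M.restrict hVU)
    (fun y ↦ ⟨σ y, hσV y⟩) (fun y ↦ ⟨t' (j y), htV y⟩)
    (dSmooth_subtypeMk hσ hσV) (dSmooth_subtypeMk (ht'.comp hj) htV) hσp (fun y ↦ by
      change L.toBase (L.bundle.act _ _) = M.toBase _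
      rw [toBase_act, hk, E.π_mk, hgk]
      rfl)
  exact ⟨F⟩

/-- The trivial lift of `P` over an open set on which `P` has a section. -/
def trivialLift [DiffeologicalGroup G] (s : U → P.Total) (hs : DSmooth s)
    (hps : ∀ x, P.proj (s x) = x.1) : LocalLift P U where
  bundle :=
    { Total := U × E.Hhat
      proj := fun p ↦ p.1.1
      proj_mem := fun p ↦ p.1.2
      smooth_proj := dSmooth_val.comp dSmooth_fst
      act := fun p h ↦ (p.1, p.2 * h)
      act_one := fun p ↦ by simp
      act_mul := fun p h k ↦ by simp [mul_assoc]
      smooth_act := dSmooth_prodMk (dSmooth_fst.comp dSmooth_fst)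
        (dSmooth_mul (dSmooth_snd.comp dSmooth_fst) dSmooth_snd)
      proj_act := fun _ _ ↦ rfl
      locally_trivial := fun x hx ↦ ⟨U, hx, le_rfl,
        (Equiv.subtypeUnivEquiv fun p ↦ p.1.2).symm, fun n p hp ↦ hp, fun n p hp ↦ hp,
        fun _ ↦ rfl, fun _ _ _ ↦ rfl⟩ }
  toBase p := P.act (s p.1) (E.π p.2)
  proj_toBase p := by rw [P.proj_act]; exact hps _
  toBase_act p h := by
    change P.act _ (E.π (p.2 * h)) = _
    rw [map_mul, P.act_mul]
  orbit p p' := by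
    constructor
    · intro h
      have h1 : p.1 = p'.1 := by
        have := congrArg P.proj h
        rw [P.proj_act, P.proj_act, hps, hps] at this
        exact Subtype.ext this
      rw [← h1] at h
      obtain ⟨a, ha⟩ := E.exists_incl_of_π (h := p.2⁻¹ * p'.2)
        (by rw [map_mul, map_inv, P.act_free h, inv_mul_cancel])
      exact ⟨a, Prod.ext h1.symm (by rw [ha]; simp)⟩
    · rintro ⟨a, rfl⟩
      change P.act _ _ = P.act _ (E.π (p.2 * E.incl a))
      rw [map_mul, E.π_incl, mul_one]
  subduction := by
    refine ⟨P.dSmooth_act (hs.comp dSmooth_fst) (E.smooth_π.comp dSmooth_snd), fun p ↦ ?_,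
      fun n p hp hU t ↦ ?_⟩
    · change P.proj (P.act _ _) ∈ U
      rw [P.proj_act, hps]; exact p.1.2
    · let β : EuclideanSpace ℝ (Fin n) → U := fun t ↦ ⟨P.proj (p t), hU t⟩
      have hβ : DSmooth β := dSmooth_subtypeMk (P.smooth_proj.comp hp.dSmooth) _
      have hk : ∀ t, ∃ k, p t = P.act (s (β t)) k := fun t ↦ P.exists_act_eq (hps _)
      choose k hk using hk
      have hks : DSmooth k := P.dSmooth_of_act_eq (hs.comp hβ) hp.dSmooth hk
      -- Here a plot is lifted, so the subduction property of `q` is enough; the lifting hypothesis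
      -- on `X` concerns maps defined on open subsets of `X`.
      obtain ⟨O, hO, ht, g, hg, hgk⟩ := E.q_subduction.2.2 n (fun t ↦ (k t).left)
        (dSmooth_left.comp hks).isPlot (fun _ ↦ trivial) t
      refine ⟨O, hO, ht, fun t ↦ (β t, ⟨g t, (k t).right⟩), (dSmooth_prodMk hβ
        (dSmooth_semidirectMk hg.dSmooth (dSmooth_right.comp hks))).isPlot, fun r hr ↦ ?_⟩
      change P.act (s (β r)) ⟨E.q (g r), (k r).right⟩ = p r
      rw [hgk r hr, hk r]

theorem locally_nonempty [DiffeologicalGroup G] (P : PrincipalBundle E.H (⊤ : Opens X)) (x : X) :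
    ∃ U : Opens X, x ∈ U ∧ Nonempty (LocalLift P U) := by
  obtain ⟨V, -, hx, s, hs, hps⟩ := P.exists_section (x := x) trivial
  exact ⟨V, hx, ⟨trivialLift s hs hps⟩⟩

end LocalLift

open Pseudofunctor LocallyDiscreteOpToCat

section

variable {X : Type u} [TopologicalSpace X] [DiffeologicalSpace X]
  {A Ghat G : Type u} [CommGroup A] [Group Ghat] [Group G]
  [DiffeologicalSpace A] [DiffeologicalSpace Ghat] [DiffeologicalSpace G]
  {E : TwistedCentralExtension A Ghat G} {P : PrincipalBundle E.H (⊤ : Opens X)} {U V W : Opens X}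

open LocalLift

/-! ### The structure morphisms of the lifting gerbe -/

/-- After identifying `fg` with the literal composite, `mapComp'` becomes `mapComp`, which is
`restrictComp` and fixes underlying points. This and the next two lemmas reduce every diagram in the
gerbe to an equality between points of total spaces. -/
lemma liftingGerbe_mapComp'_hom (f : V ⟶ U) (g : W ⟶ V) (fg : W ⟶ U)
    (h : f.op.toLoc ≫ g.op.toLoc = fg.op.toLoc) (L : LocalLift P U)
    (p : {p : L.bundle.Total // L.bundle.proj p ∈ W}) :
    ev (L := L.restrict fg.le) (M := (L.restrict f.le).restrict g.le)
      (((liftingGerbe P).mapComp' f.op.toLoc g.op.toLoc fg.op.toLoc h).hom.toNatTrans.app L) p =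
        ⟨⟨p.1, g.le p.2⟩, p.2⟩ := by
  obtain rfl : fg = g ≫ f := Subsingleton.elim _ _
  exact congrArg (fun z : (liftingGerbe P).map (f.op.toLoc ≫ g.op.toLoc) ≅
      (liftingGerbe P).map f.op.toLoc ≫ (liftingGerbe P).map g.op.toLoc ↦
    ev (L := L.restrict (f.le.trans' g.le)) (M := (L.restrict f.le).restrict g.le)
      (z.hom.toNatTrans.app L) p) (mapComp'_eq_mapComp _ f.op.toLoc g.op.toLoc)

lemma liftingGerbe_mapComp'_inv (f : V ⟶ U) (g : W ⟶ V) (fg : W ⟶ U)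
    (h : f.op.toLoc ≫ g.op.toLoc = fg.op.toLoc) (L : LocalLift P U)
    (p : {p : (L.restrict f.le).bundle.Total // (L.restrict f.le).bundle.proj p ∈ W}) :
    ev (L := (L.restrict f.le).restrict g.le) (M := L.restrict fg.le)
      (((liftingGerbe P).mapComp' f.op.toLoc g.op.toLoc fg.op.toLoc h).inv.toNatTrans.app L) p =
        ⟨p.1.1, p.2⟩ := by
  obtain rfl : fg = g ≫ f := Subsingleton.elim _ _
  exact congrArg (fun z : (liftingGerbe P).map (f.op.toLoc ≫ g.op.toLoc) ≅
      (liftingGerbe P).map f.op.toLoc ≫ (liftingGerbe P).map g.op.toLoc ↦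
    ev (L := (L.restrict f.le).restrict g.le) (M := L.restrict (f.le.trans' g.le))
      (z.inv.toNatTrans.app L) p) (mapComp'_eq_mapComp _ f.op.toLoc g.op.toLoc)

lemma liftingGerbe_pullHom {U₁ U₂ V W : Opens X} {L : LocalLift P U₁} {M : LocalLift P U₂}
    {f₁ : V ⟶ U₁} {f₂ : V ⟶ U₂} (φ : L.restrict f₁.le ⟶ M.restrict f₂.le) (g : W ⟶ V)
    (gf₁ : W ⟶ U₁) (gf₂ : W ⟶ U₂) (h₁ : g ≫ f₁ = gf₁) (h₂ : g ≫ f₂ = gf₂)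
    (p : (L.restrict gf₁.le).bundle.Total) :
    (ev (L := L.restrict gf₁.le) (M := M.restrict gf₂.le)
      (pullHom (F := liftingGerbe P) (M₁ := L) (M₂ := M) (f₁ := f₁) (f₂ := f₂) φ g gf₁ gf₂ h₁ h₂)
        p).1 = (ev φ ⟨p.1, g.le p.2⟩).1 := by
  have := liftingGerbe_mapComp'_hom f₁ g gf₁ (by rw [← h₁]; rfl) L p
  have h3 := fun q ↦ liftingGerbe_mapComp'_inv f₂ g gf₂ (by rw [← h₂]; rfl) M q
  refine (congrArg Subtype.val (h3 _)).trans ?_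
  refine congrArg (fun q ↦ (ev φ (Subtype.val q)).1) this

end

/-! ### Gluing of lifts -/

section Gluing

variable {X : Type u} [TopologicalSpace X] [DiffeologicalSpace X]
  {A Ghat G : Type u} [CommGroup A] [Group Ghat] [Group G]
  [DiffeologicalSpace A] [DiffeologicalSpace Ghat] [DiffeologicalSpace G]
  {E : TwistedCentralExtension A Ghat G}

/-- Lifts over the members of a family of open sets, with transition maps. -/
structure GluingData (P : PrincipalBundle E.H (⊤ : Opens X)) {I : Type u} (V : I → Opens X) where
  L : ∀ i, LocalLift P (V i)
  τ : ∀ i j (p : (L i).bundle.Total), (L i).bundle.proj p ∈ V j → (L j).bundle.Total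
  toBase_τ : ∀ i j p h, (L j).toBase (τ i j p h) = (L i).toBase p
  τ_act : ∀ i j p k h h', τ i j ((L i).bundle.act p k) h = (L j).bundle.act (τ i j p h') k
  τ_self : ∀ i p h, τ i i p h = p
  τ_τ : ∀ i j k p h h' h'', τ j k (τ i j p h) h' = τ i k p h''
  smooth_τ : ∀ i j, DSmooth fun p : {p // (L i).bundle.proj p ∈ V j} ↦ τ i j p.1 p.2

namespace GluingData

variable {P : PrincipalBundle E.H (⊤ : Opens X)} {I : Type u} {V : I → Opens X}
  (D : GluingData P V)

lemma proj_τ (i j p h) : (D.L j).bundle.proj (D.τ i j p h) = (D.L i).bundle.proj p := by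
  rw [← LocalLift.proj_toBase, D.toBase_τ, LocalLift.proj_toBase]

/-- Two points are identified if one is the image of the other under a transition map. -/
def setoid : Setoid (Σ i, (D.L i).bundle.Total) where
  r a b := ∃ h, D.τ a.1 b.1 a.2 h = b.2
  iseqv :=
    { refl := fun a ↦ ⟨(D.L a.1).bundle.proj_mem _, D.τ_self _ _ _⟩
      symm := by
        rintro ⟨i, p⟩ ⟨j, p'⟩ ⟨h, e⟩
        dsimp only at h e
        subst e
        refine ⟨?_, (D.τ_τ i j i p h ?_ ((D.L i).bundle.proj_mem _)).trans (D.τ_self _ _ _)⟩ <;>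
        · rw [D.proj_τ]; exact (D.L i).bundle.proj_mem _
      trans := by
        rintro ⟨i, p⟩ ⟨j, p'⟩ ⟨k, p''⟩ ⟨h, e⟩ ⟨h', e'⟩
        dsimp only at h h' e e'
        subst e e'
        have h'' := h'
        rw [D.proj_τ] at h''
        exact ⟨h'', (D.τ_τ i j k p h h' h'').symm⟩ }

/-- The total space of the glued bundle. -/
def Total : Type u := Quotient D.setoid

/-- The inclusion of the total space of the lift with index `i`. -/
def incl (i : I) (p : (D.L i).bundle.Total) : D.Total := Quotient.mk D.setoid ⟨i, p⟩

lemma incl_τ (i j p h) : D.incl j (D.τ i j p h) = D.incl i p :=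
  (Quotient.sound (s := D.setoid) ⟨h, rfl⟩).symm

lemma incl_eq_incl {i j : I} {p p'} (h : D.incl i p = D.incl j p') :
    ∃ h, D.τ i j p h = p' := Quotient.exact (s := D.setoid) h

lemma incl_injective (i : I) : Function.Injective (D.incl i) := fun p p' h ↦ by
  obtain ⟨h, rfl⟩ := D.incl_eq_incl h
  rw [D.τ_self]

lemma exists_incl (z : D.Total) : ∃ i p, D.incl i p = z := by
  obtain ⟨⟨i, p⟩, rfl⟩ := Quotient.exists_rep z
  exact ⟨i, p, rfl⟩

/-- The projection of the glued bundle. -/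
def proj : D.Total → X := Quotient.lift (fun a ↦ (D.L a.1).bundle.proj a.2) (by
  rintro ⟨i, p⟩ ⟨j, p'⟩ ⟨h, e⟩
  dsimp only at h e
  subst e
  exact (D.proj_τ i j p h).symm)

@[simp]
lemma proj_incl (i p) : D.proj (D.incl i p) = (D.L i).bundle.proj p := rfl

/-- The action on the glued bundle. -/
def act (z : D.Total) (k : E.Hhat) : D.Total :=
  Quotient.lift (fun a ↦ D.incl a.1 ((D.L a.1).bundle.act a.2 k)) (by
    rintro ⟨i, p⟩ ⟨j, p'⟩ ⟨h, e⟩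
    dsimp only at h e
    subst e
    rw [← D.τ_act i j p k (by rw [PrincipalBundle.proj_act]; exact h), D.incl_τ]) z

@[simp]
lemma act_incl (i p k) : D.act (D.incl i p) k = D.incl i ((D.L i).bundle.act p k) := rfl

/-- The projection of the glued lift to `P`. -/
def toBase : D.Total → P.Total := Quotient.lift (fun a ↦ (D.L a.1).toBase a.2) (by
  rintro ⟨i, p⟩ ⟨j, p'⟩ ⟨h, e⟩
  dsimp only at h e
  subst e
  exact (D.toBase_τ i j p h).symm)

@[simp]
lemma toBase_incl (i p) : D.toBase (D.incl i p) = (D.L i).toBase p := rfl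

lemma exists_incl_of_mem {z : D.Total} {i : I} (h : D.proj z ∈ V i) : ∃ p, D.incl i p = z := by
  obtain ⟨j, p, rfl⟩ := D.exists_incl z
  exact ⟨_, D.incl_τ j i p h⟩

/-- A curve need not stay in one chart, so smoothness is tested on the reparametrizations `c ∘ φ`
that lift to some `D.L j`. Quantifying over `φ` builds in stability under reparametrization. The
first clause makes the projection smooth, so the preimages of the `V j` under plots are open and
local arguments become available. -/
instance : DiffeologicalSpace D.Total where
  plots n := {c | IsPlot (fun t ↦ D.proj (c t)) ∧
    ∀ (m : ℕ) (φ : EuclideanSpace ℝ (Fin m) → EuclideanSpace ℝ (Fin n)),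
      ContDiff ℝ (⊤ : ℕ∞) φ → ∀ (j : I) (p : EuclideanSpace ℝ (Fin m) → (D.L j).bundle.Total),
        (∀ t, D.incl j (p t) = c (φ t)) → IsPlot p}
  constant_plots z := ⟨isPlot_const, fun m φ _ j p hp ↦ by
    have : p = fun _ ↦ p 0 := funext fun t ↦ D.incl_injective j ((hp t).trans (hp 0).symm)
    rw [this]
    exact isPlot_const⟩
  plot_reparam hp hf := ⟨isPlot_reparam hp.1 hf, fun m φ hφ j p h ↦ hp.2 m _ (hf.comp hφ) j p h⟩
  locality {n c} hc := by
    refine ⟨DiffeologicalSpace.locality fun t ↦ ?_, fun m φ hφ j p hp ↦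
      DiffeologicalSpace.locality fun t ↦ ?_⟩
    · obtain ⟨O, hO, ht, h⟩ := hc t
      exact ⟨O, hO, ht, fun hf hf' ↦ (h hf hf').1⟩
    · obtain ⟨O, hO, ht, h⟩ := hc (φ t)
      exact ⟨φ ⁻¹' O, hO.preimage hφ.continuous, ht, fun {k f} hf hf' ↦
        (h (f := φ ∘ f) hf (hφ.comp hf')).2 k id contDiff_id j _ fun s ↦ hp (f s)⟩

lemma isPlot_iff {n : ℕ} {c : EuclideanSpace ℝ (Fin n) → D.Total} :
    IsPlot c ↔ IsPlot (fun t ↦ D.proj (c t)) ∧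
      ∀ (m : ℕ) (φ : EuclideanSpace ℝ (Fin m) → EuclideanSpace ℝ (Fin n)),
        ContDiff ℝ (⊤ : ℕ∞) φ → ∀ (j : I) (p : EuclideanSpace ℝ (Fin m) → (D.L j).bundle.Total),
          (∀ t, D.incl j (p t) = c (φ t)) → IsPlot p := Iff.rfl

lemma smooth_proj : DSmooth D.proj := fun _ _ hc ↦ hc.1

/-- A lift of `D.incl i ∘ p ∘ φ` to another chart `j` is forced to be the image of `p ∘ φ` under the
smooth transition map `τ i j`. -/
lemma smooth_incl (i : I) : DSmooth (D.incl i) := fun n p hp ↦ by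
  refine D.isPlot_iff.2 ⟨(D.L i).bundle.smooth_proj n p hp, fun m φ hφ j p' hp' ↦ ?_⟩
  have h := fun t ↦ D.incl_eq_incl (hp' t).symm
  choose h h' using h
  rw [← funext h']
  exact D.smooth_τ i j m (fun t ↦ ⟨p (φ t), h t⟩) (isPlot_reparam hp hφ)

lemma isPlot_of_incl {n : ℕ} {c : EuclideanSpace ℝ (Fin n) → D.Total} (hc : IsPlot c) {j : I}
    {p : EuclideanSpace ℝ (Fin n) → (D.L j).bundle.Total} (hp : ∀ t, D.incl j (p t) = c t) :
    IsPlot p := (D.isPlot_iff.1 hc).2 n id contDiff_id j p hp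

/-- The part of the glued bundle over an open subset of `V i`. -/
def chart (i : I) {W : Opens X} (hW : W ≤ V i) :
    {p // (D.L i).bundle.proj p ∈ W} ≃ {z // D.proj z ∈ W} :=
  Equiv.ofBijective (fun p ↦ ⟨D.incl i p.1, p.2⟩)
    ⟨fun p p' h ↦ Subtype.ext (D.incl_injective i (congrArg Subtype.val h)), fun ⟨z, hz⟩ ↦ by
      obtain ⟨p, rfl⟩ := D.exists_incl_of_mem (hW hz)
      exact ⟨⟨p, hz⟩, rfl⟩⟩

lemma incl_chart_symm (i : I) {W : Opens X} (hW : W ≤ V i) (z : {z // D.proj z ∈ W}) :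
    D.incl i ((D.chart i hW).symm z).1 = z.1 :=
  congrArg Subtype.val ((D.chart i hW).apply_symm_apply z)

lemma smooth_chart (i : I) {W : Opens X} (hW : W ≤ V i) : DSmooth (D.chart i hW) :=
  dSmooth_subtypeMk ((D.smooth_incl i).comp dSmooth_val) _

lemma smooth_chart_symm (i : I) {W : Opens X} (hW : W ≤ V i) : DSmooth (D.chart i hW).symm :=
  fun _ c hc ↦ D.isPlot_of_incl (c := fun t ↦ (c t).1) hc fun t ↦ D.incl_chart_symm i hW (c t)

variable [IsDTopologyCompatible X] {U : Opens X}

lemma smooth_toBase : DSmooth D.toBase := by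
  refine dSmooth_of_local D.smooth_proj fun z ↦ ?_
  obtain ⟨i, p, rfl⟩ := D.exists_incl z
  refine ⟨V i, (D.L i).bundle.proj_mem p, ?_⟩
  have : (fun z : {z // D.proj z ∈ V i} ↦ D.toBase z.1) =
      fun z ↦ (D.L i).toBase ((D.chart i le_rfl).symm z).1 :=
    funext fun z ↦ by rw [← toBase_incl, D.incl_chart_symm]
  rw [this]
  exact (D.L i).subduction.1.comp (dSmooth_val.comp (D.smooth_chart_symm i le_rfl))

variable [DiffeologicalGroup Ghat]

/-- The glued bundle. -/
def bundle (hV : ∀ i, V i ≤ U) (hU : ∀ x ∈ U, ∃ i, x ∈ V i) : PrincipalBundle E.Hhat U where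
  Total := D.Total
  proj := D.proj
  proj_mem z := by
    obtain ⟨i, p, rfl⟩ := D.exists_incl z
    exact hV i ((D.L i).bundle.proj_mem p)
  smooth_proj := D.smooth_proj
  act := D.act
  act_one z := by
    obtain ⟨i, p, rfl⟩ := D.exists_incl z
    rw [act_incl, PrincipalBundle.act_one]
  act_mul z h k := by
    obtain ⟨i, p, rfl⟩ := D.exists_incl z
    rw [act_incl, act_incl, act_incl, PrincipalBundle.act_mul]
  smooth_act n c hc := by
    have hproj : ∀ z k, D.proj (D.act z k) = D.proj z := fun z k ↦ by
      obtain ⟨i, p, rfl⟩ := D.exists_incl z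
      rw [act_incl, proj_incl, proj_incl, PrincipalBundle.proj_act]
    refine D.isPlot_iff.2 ⟨?_, fun m φ hφ j p hp ↦ ?_⟩
    · change IsPlot fun t ↦ D.proj (D.act (c t).1 (c t).2)
      simp only [hproj]
      exact D.smooth_proj n _ hc.1
    · have hk : DSmooth fun t ↦ (c (φ t)).2 := (isPlot_reparam hc.2 hφ).dSmooth
      -- The curve `p` lifts the translated curve. Translating it back gives a lift of the original
      -- one, a plot by hypothesis; the smooth action of `D.L j` then recovers `p`.
      have hp' : IsPlot fun t ↦ (D.L j).bundle.act (p t) (c (φ t)).2⁻¹ := by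
        refine (D.isPlot_iff.1 hc.1).2 m φ hφ j _ fun t ↦ ?_
        rw [← act_incl, hp]
        change D.act (D.act (c (φ t)).1 (c (φ t)).2) _ = _
        obtain ⟨i, p', h⟩ := D.exists_incl (c (φ t)).1
        rw [← h, act_incl, act_incl, PrincipalBundle.act_inv_act]
      have : p = fun t ↦ (D.L j).bundle.act ((D.L j).bundle.act (p t) (c (φ t)).2⁻¹) (c (φ t)).2 :=
        funext fun t ↦ by rw [← PrincipalBundle.act_mul, inv_mul_cancel, PrincipalBundle.act_one]
      rw [this]
      exact ((D.L j).bundle.dSmooth_act hp'.dSmooth hk).isPlot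
  proj_act z k := by
    obtain ⟨i, p, rfl⟩ := D.exists_incl z
    rw [act_incl, proj_incl, proj_incl, PrincipalBundle.proj_act]
  locally_trivial x hx := by
    obtain ⟨i, hi⟩ := hU x hx
    obtain ⟨W, hxW, hW, e, h1, h2, h3, h4⟩ := (D.L i).bundle.locally_trivial x hi
    exact ⟨W, hxW, hW.trans (hV i), e.trans (D.chart i hW), (D.smooth_chart i hW).comp h1,
      h2.comp (D.smooth_chart_symm i hW), fun z ↦ h3 z, fun x h k ↦ congrArg (D.incl i) (h4 x h k)⟩

/-- The glued lift. -/
def glue (hV : ∀ i, V i ≤ U) (hU : ∀ x ∈ U, ∃ i, x ∈ V i) : LocalLift P U where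
  bundle := D.bundle hV hU
  toBase := D.toBase
  proj_toBase z := by
    obtain ⟨i, p, rfl⟩ := D.exists_incl z
    exact (D.L i).proj_toBase p
  toBase_act z k := by
    obtain ⟨i, p, rfl⟩ := D.exists_incl z
    exact (D.L i).toBase_act p k
  orbit z z' := by
    obtain ⟨i, p, rfl⟩ := D.exists_incl z
    constructor
    · intro h
      have hz' : D.proj z' ∈ V i := by
        obtain ⟨j, p', rfl⟩ := D.exists_incl z'
        have := congrArg P.proj h
        rw [toBase_incl, toBase_incl, LocalLift.proj_toBase, LocalLift.proj_toBase] at this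
        rw [proj_incl, ← this]
        exact (D.L i).bundle.proj_mem p
      obtain ⟨p', rfl⟩ := D.exists_incl_of_mem hz'
      obtain ⟨a, rfl⟩ := ((D.L i).orbit p p').1 h
      exact ⟨a, rfl⟩
    · rintro ⟨a, rfl⟩
      exact ((D.L i).orbit p _).2 ⟨a, rfl⟩
  subduction := by
    refine ⟨D.smooth_toBase, fun z ↦ ?_, fun n p hp hpU t ↦ ?_⟩
    · obtain ⟨i, p, rfl⟩ := D.exists_incl z
      exact hV i ((D.L i).subduction.2.1 p)
    · obtain ⟨i, hi⟩ := hU _ (hpU t)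
      -- The plot is first pushed into the part of `P` above `V i`, since only there does `D.L i`
      -- lift it.
      obtain ⟨φ, hφ, hφO, W, hW, htW, hφW⟩ := exists_smooth_retract
        (isOpen_preimage_of_isPlot (V i) (P.smooth_proj n p hp)) (t := t) hi
      obtain ⟨O, hO, htO, p', hp', h⟩ := (D.L i).subduction.2.2 n (p ∘ φ) (isPlot_reparam hp hφ)
        hφO t
      refine ⟨O ∩ W, hO.inter hW, ⟨htO, htW⟩, D.incl i ∘ p', D.smooth_incl i n p' hp', fun s hs ↦ ?_⟩
      exact (h s hs.1).trans (congrArg p (hφW s hs.2))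

/-- The inclusions of the charts are smooth, equivariant and compatible with `toBase`, which by
`exists_hom_of_map` already makes them isomorphisms onto the restrictions of the glued lift. They
respect `τ` because points related by `τ` were identified. -/
theorem exists_glue (hV : ∀ i, V i ≤ U) (hU : ∀ x ∈ U, ∃ i, x ∈ V i) :
    ∃ (L : LocalLift P U) (F : ∀ i, D.L i ⟶ L.restrict (hV i)),
      ∀ i j p h, (LocalLift.ev (F j) (D.τ i j p h)).1 = (LocalLift.ev (F i) p).1 := by
  have (i : I) : ∃ F : D.L i ⟶ (D.glue hV hU).restrict (hV i), ∀ p,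
      LocalLift.ev F p = ⟨D.incl i p, (D.L i).bundle.proj_mem p⟩ :=
    LocalLift.exists_hom_of_map (M := (D.glue hV hU).restrict (hV i))
      (fun p ↦ ⟨D.incl i p, (D.L i).bundle.proj_mem p⟩)
      (dSmooth_subtypeMk (D.smooth_incl i) _) (fun _ _ ↦ rfl) (fun _ ↦ rfl)
  choose F hF using this
  refine ⟨D.glue hV hU, F, fun i j p h ↦ ?_⟩
  rw [hF, hF]
  exact D.incl_τ i j p h

end GluingData

end Gluing

/-! ### Descent for lifts -/

section Stack

open Pseudofunctor LocallyDiscreteOpToCat LocalLift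

variable {X : Type u} [TopologicalSpace X] [DiffeologicalSpace X]
  {A Ghat G : Type u} [CommGroup A] [Group Ghat] [Group G]
  [DiffeologicalSpace A] [DiffeologicalSpace Ghat] [DiffeologicalSpace G]
  {E : TwistedCentralExtension A Ghat G} {P : PrincipalBundle E.H (⊤ : Opens X)}
  {U : Opens X} {I : Type u} {V : I → Opens X} {f : ∀ i, V i ⟶ U}

lemma ofObj_hom_val (L : LocalLift P U) {W : Opens X} (q : W ⟶ U) {i j : I} (f₁ : W ⟶ V i)
    (f₂ : W ⟶ V j) (h₁ : f₁ ≫ f i = q) (h₂ : f₂ ≫ f j = q)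
    (p : ((L.restrict (f i).le).restrict f₁.le).bundle.Total) :
    (ev (L := (L.restrict (f i).le).restrict f₁.le) (M := (L.restrict (f j).le).restrict f₂.le)
      ((DescentData.ofObj (F := liftingGerbe P) (f := f) L).hom q f₁ f₂ h₁ h₂) p).1.1 = p.1.1 := by
  have h3 := liftingGerbe_mapComp'_inv (f i) f₁ q (by rw [← h₁]; rfl) L p
  have h4 := fun z ↦ liftingGerbe_mapComp'_hom (f j) f₂ q (by rw [← h₂]; rfl) L z
  refine (congrArg (fun z ↦ z.1.1) (h4 _)).trans ?_
  exact congrArg Subtype.val h3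

lemma toDescentData_faithful (hU : ∀ x ∈ U, ∃ i, x ∈ V i) :
    ((liftingGerbe P).toDescentData f).Faithful where
  map_injective {L M} φ ψ h := by
    refine LocalLift.hom_ext (L := L) (M := M) fun p ↦ ?_
    obtain ⟨i, hi⟩ := hU _ (L.bundle.proj_mem p)
    have := congrArg (fun g ↦ DescentData.Hom.hom g i) h
    exact congrArg (fun g ↦ (ev (L := L.restrict (f i).le) (M := M.restrict (f i).le) g
      ⟨p, hi⟩).1) this

/-- Every transition morphism of a descent datum is restricted from the one over `V i ⊓ V j`, so
these pairwise morphisms contain all the information. This is what allows passing to `GluingData`.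
-/
lemma descentData_hom_val (D : (liftingGerbe P).DescentData f) {W : Opens X} {i j : I} (q : W ⟶ U)
    (f₁ : W ⟶ V i) (f₂ : W ⟶ V j) (h₁ : f₁ ≫ f i = q) (h₂ : f₂ ≫ f j = q)
    (p : (LocalLift.restrict (D.obj i) f₁.le).bundle.Total) :
    (ev (L := LocalLift.restrict (D.obj i) f₁.le) (M := LocalLift.restrict (D.obj j) f₂.le)
      (D.hom q f₁ f₂ h₁ h₂) p).1 =
    (ev (L := LocalLift.restrict (D.obj i) inf_le_left)
      (M := LocalLift.restrict (D.obj j) inf_le_right)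
      (D.hom (homOfLE (inf_le_left : V i ⊓ V j ≤ V i) ≫ f i) (homOfLE inf_le_left)
        (homOfLE inf_le_right)) ⟨p.1, f₁.le p.2, f₂.le p.2⟩).1 := by
  have := D.pullHom_hom (homOfLE (le_inf f₁.le f₂.le)) (homOfLE inf_le_left ≫ f i) q
    (Subsingleton.elim _ _) (homOfLE inf_le_left) (homOfLE inf_le_right) rfl
    (Subsingleton.elim _ _) f₁ f₂ (Subsingleton.elim _ _) (Subsingleton.elim _ _)
  refine (congrArg (fun g ↦ (ev (L := LocalLift.restrict (D.obj i) f₁.le)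
    (M := LocalLift.restrict (D.obj j) f₂.le) g p).1) this).symm.trans ?_
  exact liftingGerbe_pullHom (L := D.obj i) (M := D.obj j)
    (D.hom (homOfLE inf_le_left ≫ f i) (homOfLE inf_le_left) (homOfLE inf_le_right))
    (homOfLE (le_inf f₁.le f₂.le)) f₁ f₂ (Subsingleton.elim _ _) (Subsingleton.elim _ _) p

/-- The gluing data given by a descent datum of the lifting gerbe. -/
def gluingData (D : (liftingGerbe P).DescentData f) : GluingData P V :=
  let L (i : I) : LocalLift P (V i) := D.obj i
  let T (i j : I) : (L i).restrict (inf_le_left : V i ⊓ V j ≤ V i) ⟶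
    (L j).restrict (inf_le_right : V i ⊓ V j ≤ V j) :=
      D.hom (homOfLE inf_le_left ≫ f i) (homOfLE inf_le_left) (homOfLE inf_le_right)
  { L := L
    τ := fun i j p h ↦ (ev (T i j) ⟨p, (L i).bundle.proj_mem p, h⟩).1
    toBase_τ := fun i j p h ↦ toBase_ev (T i j) _
    τ_act := fun i j p k h h' ↦
      congrArg Subtype.val (ev_act (T i j) ⟨p, (L i).bundle.proj_mem p, h'⟩ k)
    τ_self := fun i p h ↦ by
      have := D.hom_self (homOfLE inf_le_left ≫ f i) (homOfLE (inf_le_left : V i ⊓ V i ≤ V i)) rfl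
      exact congrArg (fun g ↦ (ev (L := (L i).restrict inf_le_left)
        (M := (L i).restrict inf_le_left) g ⟨p, (L i).bundle.proj_mem p, h⟩).1) this
    τ_τ := fun i j k p h h' h'' ↦ by
      -- The composition law of the descent datum is read over the triple intersection, then its
      -- three morphisms are traced back to the pairwise intersections.
      let W := V i ⊓ V j ⊓ V k
      let q : W ⟶ U := homOfLE (fun x hx ↦ (f i).le hx.1.1)
      let f₁ : W ⟶ V i := homOfLE (fun x hx ↦ hx.1.1)
      let f₂ : W ⟶ V j := homOfLE (fun x hx ↦ hx.1.2)
      let f₃ : W ⟶ V k := homOfLE (fun x hx ↦ hx.2)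
      let p' : ((L i).restrict f₁.le).bundle.Total := ⟨p, ⟨(L i).bundle.proj_mem p, h⟩, h''⟩
      have := D.hom_comp q f₁ f₂ f₃ (Subsingleton.elim _ _) (Subsingleton.elim _ _)
        (Subsingleton.elim _ _)
      have h3 := congrArg (fun g ↦ (ev (L := (L i).restrict f₁.le)
        (M := (L k).restrict f₃.le) g p').1) this
      have e1 := descentData_hom_val D q f₁ f₂ (Subsingleton.elim _ _) (Subsingleton.elim _ _) p'
      have e2 := fun z ↦ descentData_hom_val D q f₂ f₃ (Subsingleton.elim _ _) (Subsingleton.elim _ _) z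
      have e3 := descentData_hom_val D q f₁ f₃ (Subsingleton.elim _ _) (Subsingleton.elim _ _) p'
      refine Eq.trans ?_ (((e2 _).symm.trans h3).trans e3)
      exact congrArg (fun z ↦ (ev (T j k) z).1) (Subtype.ext e1.symm)
    smooth_τ := fun i j n p hp ↦ smooth_ev (T i j) n
      (fun t ↦ ⟨(p t).1, (L i).bundle.proj_mem _, (p t).2⟩) hp }

variable [IsDTopologyCompatible X] [DiffeologicalGroup Ghat]

/-- Compatibility of the local morphisms means that they agree pointwise on overlaps, so they define
one map whose value does not depend on the chosen index `k p`. Smoothness is local on the base, and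
the inverse comes from `exists_hom_of_map`. -/
lemma toDescentData_full (hU : ∀ x ∈ U, ∃ i, x ∈ V i) :
    ((liftingGerbe P).toDescentData f).Full where
  map_surjective {L M} g := by
    let g' (i : I) : L.restrict (f i).le ⟶ M.restrict (f i).le := DescentData.Hom.hom g i
    have hcomm (i j : I) (p : L.bundle.Total) (hi : L.bundle.proj p ∈ V i)
        (hj : L.bundle.proj p ∈ V j) : (ev (g' i) ⟨p, hi⟩).1 = (ev (g' j) ⟨p, hj⟩).1 := by
      let W := V i ⊓ V j
      let f₁ : W ⟶ V i := homOfLE inf_le_left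
      let f₂ : W ⟶ V j := homOfLE inf_le_right
      have h := DescentData.Hom.comm g (f₁ ≫ f i) f₁ f₂ rfl rfl
      let p' : ((L.restrict (f i).le).restrict f₁.le).bundle.Total := ⟨⟨p, hi⟩, hi, hj⟩
      have h' := congrArg (fun k ↦ (ev (L := (L.restrict (f i).le).restrict f₁.le)
        (M := (M.restrict (f j).le).restrict f₂.le) k p').1.1) h
      have e1 := ofObj_hom_val (f := f) L (f₁ ≫ f i) f₁ f₂ rfl rfl p'
      have e2 := fun z ↦ ofObj_hom_val (f := f) M (f₁ ≫ f i) f₁ f₂ rfl rfl z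
      refine (e2 _).symm.trans (h'.trans ?_)
      exact congrArg (fun z ↦ (ev (g' j) z).1) (Subtype.ext e1)
    choose k hk using fun p ↦ hU _ (L.bundle.proj_mem p)
    have hF : ∀ i p (hi : L.bundle.proj p ∈ V i),
        (ev (g' (k p)) ⟨p, hk p⟩).1 = (ev (g' i) ⟨p, hi⟩).1 := fun i p hi ↦ hcomm _ _ _ _ _
    obtain ⟨F, hFk⟩ := exists_hom_of_map (L := L) (M := M) (fun p ↦ (ev (g' (k p)) ⟨p, hk p⟩).1)
      (by
        refine dSmooth_of_local L.bundle.smooth_proj fun p ↦ ⟨V (k p), hk p, ?_⟩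
        have : (fun z : {z // L.bundle.proj z ∈ V (k p)} ↦ (ev (g' (k z.1)) ⟨z.1, hk z.1⟩).1) =
          fun z ↦ (ev (g' (k p)) z).1 := funext fun z ↦ hF _ _ _
        rw [this]
        exact dSmooth_val.comp (smooth_ev (g' (k p))))
      (fun p h ↦ by
        have hp : L.bundle.proj (L.bundle.act p h) ∈ V (k p) := by
          rw [PrincipalBundle.proj_act]; exact hk p
        rw [hF (k p) _ hp]
        exact congrArg Subtype.val (ev_act (g' (k p)) ⟨p, hk p⟩ h))
      (fun p ↦ toBase_ev (g' (k p)) ⟨p, hk p⟩)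
    refine ⟨F, DescentData.hom_ext fun i ↦ LocalLift.hom_ext (L := L.restrict (f i).le)
      (M := M.restrict (f i).le) fun p ↦ Subtype.ext ?_⟩
    exact (hFk p.1).trans (hF i p.1 p.2)

lemma toDescentData_essSurj (hU : ∀ x ∈ U, ∃ i, x ∈ V i) :
    ((liftingGerbe P).toDescentData f).EssSurj where
  mem_essImage D := by
    obtain ⟨L, F, hF⟩ := (gluingData D).exists_glue (fun i ↦ (f i).le) hU
    let e (i : I) : (DescentData.ofObj (F := liftingGerbe P) (f := f) L).obj i ≅ D.obj i :=
      ((Groupoid.isoEquivHom ((gluingData D).L i) (L.restrict (f i).le)).symm (F i)).symm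
    let e' : D ≅ DescentData.ofObj (F := liftingGerbe P) (f := f) L :=
      DescentData.isoMk (fun i ↦ (e i).symm) (fun W q i j f₁ f₂ h₁ h₂ ↦ by
        refine LocalLift.hom_ext (L := ((gluingData D).L i).restrict f₁.le)
          (M := (L.restrict (f j).le).restrict f₂.le) fun p ↦ Subtype.ext (Subtype.ext ?_)
        have e1 := descentData_hom_val D q f₁ f₂ h₁ h₂ p
        have e2 := ofObj_hom_val (f := f) L q f₁ f₂ h₁ h₂ ⟨ev (F i) p.1, by
          rw [proj_ev]; exact p.2⟩
        refine e2.trans ((hF i j p.1 (f₂.le p.2)).symm.trans ?_)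
        exact congrArg (fun z ↦ (ev (F j) z).1) e1.symm)
    exact ⟨L, ⟨e'.symm⟩⟩

theorem liftingGerbe_isStack (P : PrincipalBundle E.H (⊤ : Opens X)) :
    (liftingGerbe P).IsStack (Opens.grothendieckTopology X) := by
  refine IsStack.of_isStackFor fun U R hR ↦ ⟨?_⟩
  -- A covering sieve in the topology of opens is a family of open subsets that contains every point
  -- of `U` in some member.
  have hU : ∀ x ∈ U, ∃ i : R.arrows.category, x ∈ i.obj.left := fun x hx ↦ by
    obtain ⟨W, g, hg, hxW⟩ := hR x hx
    exact ⟨⟨Over.mk g, hg⟩, hxW⟩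
  have := toDescentData_faithful (P := P) (f := fun i : R.arrows.category ↦ i.obj.hom) hU
  have := toDescentData_full (P := P) (f := fun i : R.arrows.category ↦ i.obj.hom) hU
  have := toDescentData_essSurj (P := P) (f := fun i : R.arrows.category ↦ i.obj.hom) hU
  exact { }

theorem liftingGerbe_isGerbe [DiffeologicalGroup G] (hE : E.LiftsLocallyOn X)
    (P : PrincipalBundle E.H (⊤ : Opens X)) : IsGerbe (liftingGerbe P) where
  isStack := liftingGerbe_isStack P
  isIso U x y f := ((Groupoid.isoEquivHom (C := LocalLift P U) x y).symm f).isIso_hom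
  locally_nonempty x := LocalLift.locally_nonempty P x
  locally_connected U L M x hx := by
    obtain ⟨V, h, hxV, ⟨F⟩⟩ := LocalLift.locally_connected hE L M hx
    exact ⟨V, h, hxV, ⟨(Groupoid.isoEquivHom (C := LocalLift P V) _ _).symm F⟩⟩

end Stack

/-! ### Sections of the local system -/

lemma Cover.exists_mem {X : Type u} [TopologicalSpace X] (𝒰 : Cover X) (x : X) :
    ∃ i, x ∈ 𝒰.set i :=
  Opens.mem_iSup.1 (by rw [𝒰.covers]; trivial)

section LocalSystem

variable {X : Type u} [TopologicalSpace X] [DiffeologicalSpace X]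
  {A Ghat G : Type u} [CommGroup A] [Group Ghat] [Group G]
  [DiffeologicalSpace A] [DiffeologicalSpace Ghat] [DiffeologicalSpace G]
  {E : TwistedCentralExtension A Ghat G} {U V : Opens X}

lemma Z2Cocycle.ε_self (z : Z2Cocycle X) (i : z.cover.idx) (x : X) (hi : x ∈ z.cover.set i) :
    z.ε i i ⟨x, hi, hi⟩ = 1 := by
  exact mul_eq_left.1 (z.cocycle i i i x hi hi hi)

variable [DiffeologicalGroup A] {z : Z2Cocycle X}

lemma section_ext {a b : (localSystem E z).obj (op U)}
    (h : ∀ i x hU hi, component a i x hU hi = component b i x hU hi) : a = b :=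
  Subtype.ext (funext fun i ↦ funext fun x ↦ h i x.1 x.2.1 x.2.2)

lemma smooth_component (a : (localSystem E z).obj (op U)) (i : z.cover.idx) :
    DSmooth fun y : ↥(U ⊓ z.cover.set i) ↦ component a i y.1 y.2.1 y.2.2 :=
  (show localSections E z U from a).2.1 i

lemma component_eq_actA (a : (localSystem E z).obj (op U)) (i j x hU hi hj) :
    component a i x hU hi = E.actA (z.ε i j ⟨x, hi, hj⟩) (component a j x hU hj) :=
  E.ι_injective (by
    rw [E.ι_actA]; exact (show localSections E z U from a).2.2 i j x hU hi hj)

variable (E) in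
/-- The section of the local system with given components. -/
def mkSection (b : ∀ i (x : X), x ∈ U → x ∈ z.cover.set i → A)
    (hb : ∀ i, DSmooth fun y : ↥(U ⊓ z.cover.set i) ↦ b i y.1 y.2.1 y.2.2)
    (h : ∀ i j x hU hi hj, b i x hU hi = E.actA (z.ε i j ⟨x, hi, hj⟩) (b j x hU hj)) :
    (localSystem E z).obj (op U) :=
  (⟨fun i y ↦ b i y.1 y.2.1 y.2.2, hb, fun i j x hU hi hj ↦ by
    rw [← E.ι_actA, ← h]⟩ : localSections E z U)

lemma component_mkSection (b : ∀ i (x : X), x ∈ U → x ∈ z.cover.set i → A) (hb h i x hU hi) :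
    component (mkSection E b hb h) i x hU hi = b i x hU hi := rfl

/-- Over an open subset of a member of the cover, a smooth function with values in `A` is the
component of a section of the local system. -/
lemma exists_section_component_eq {i : z.cover.idx} (hi : U ≤ z.cover.set i) (b : U → A)
    (hb : DSmooth b) : ∃ a : (localSystem E z).obj (op U), ∀ x hU,
      component a i x hU (hi hU) = b ⟨x, hU⟩ := by
  -- The gluing rule forces the component in any other frame `j`: it is the `i`-th one moved by
  -- `ε_ji`.
  refine ⟨mkSection E (fun j x hU hj ↦ E.actA (z.ε j i ⟨x, hj, hi hU⟩) (b ⟨x, hU⟩)) (fun j ↦ ?_)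
    (fun j k x hU hj hk ↦ ?_), fun x hU ↦ ?_⟩
  · exact E.smooth_actA
      ((z.smooth_ε j i).comp (dSmooth_subtypeMk dSmooth_val fun y ↦ ⟨y.2.2, hi y.2.1⟩))
      (hb.comp (dSmooth_subtypeMk dSmooth_val fun y ↦ y.2.1))
  · rw [← E.actA_mul_left, z.cocycle j k i x hj hk (hi hU)]
  · rw [component_mkSection, z.ε_self i x (hi hU), E.actA_one_left]

/-- Smoothness can be checked on an open cover and the gluing rule at each point. The glued section
thus takes its value at `x` from any member of the family containing `x`, all of which agree there.
-/
theorem localSystem_isSheaf [IsDTopologyCompatible X] (z : Z2Cocycle X) :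
    Presheaf.IsSheaf (Opens.grothendieckTopology X) (localSystem E z) := by
  change TopCat.Presheaf.IsSheaf (X := TopCat.of X) (localSystem E z)
  rw [TopCat.Presheaf.isSheaf_iff_isSheafUniqueGluing]
  intro I V a ha
  have ha' : ∀ m n i x (hm : x ∈ V m) (hn : x ∈ V n) (hi : x ∈ z.cover.set i),
      component (E := E) (a m) i x hm hi = component (E := E) (a n) i x hn hi :=
    fun m n i x hm hn hi ↦ congrArg (fun b ↦ component (E := E) (z := z) (U := V m ⊓ V n) b i x
      ⟨hm, hn⟩ hi) (ha m n)
  have hV : ∀ x, x ∈ iSup V → ∃ m, x ∈ V m := fun x hx ↦ Opens.mem_iSup.1 hx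
  choose k hk using hV
  refine ⟨mkSection E (U := iSup V)
    (fun i x hU hi ↦ component (E := E) (z := z) (a (k x hU)) i x (hk x hU) hi) (fun i ↦ ?_)
    (fun i j x hU hi hj ↦ component_eq_actA (a (k x hU)) i j x (hk x hU) hi hj), fun m ↦ ?_,
    fun b hb ↦ ?_⟩
  · refine dSmooth_of_local dSmooth_val fun y ↦ ⟨V (k y.1 y.2.1), hk _ _, ?_⟩
    have : DSmooth fun w : {w : ↥(iSup V ⊓ z.cover.set i) // w.1 ∈ V (k y.1 y.2.1)} ↦
        component (E := E) (z := z) (a (k y.1 y.2.1)) i w.1.1 w.2 w.1.2.2 :=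
      (smooth_component (E := E) (z := z) (a (k y.1 y.2.1)) i).comp
        (dSmooth_subtypeMk (dSmooth_val.comp dSmooth_val) fun w ↦ ⟨w.2, w.1.2.2⟩)
    convert! this using 2 with w
    exact ha' _ _ _ _ _ _ _
  · exact section_ext fun i x hx hi ↦ ha' _ _ i x (hk x (Opens.mem_iSup.2 ⟨m, hx⟩)) hx hi
  · refine section_ext fun i x hx hi ↦ ?_
    rw [component_mkSection, ← hb (k x hx)]
    rfl

end LocalSystem

/-! ### Automorphisms of lifts -/

section Automorphisms

variable {X : Type u} [TopologicalSpace X] [DiffeologicalSpace X]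
  {A Ghat G : Type u} [CommGroup A] [Group Ghat] [Group G]
  [DiffeologicalSpace A] [DiffeologicalSpace Ghat] [DiffeologicalSpace G]
  [DiffeologicalGroup A]
  {E : TwistedCentralExtension A Ghat G} {P : PrincipalBundle E.H (⊤ : Opens X)}
  (T : Trivialization P) {U V : Opens X}

/-- The candidate value does not depend on the frame: passing from `s i` to `s j` changes the
component by `ε_ij` and the sign of the coordinate `k` by the same factor, and the two changes
cancel. -/
lemma exists_value (a : (localSystem E T.twist).obj (op U)) (p : P.Total) (hp : P.proj p ∈ U) :
    ∃ v : A, ∀ (i : T.cover.idx) (hi : P.proj p ∈ T.cover.set i) (k : E.H),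
      p = P.act (T.s i ⟨P.proj p, hi⟩) k →
        v = E.actA k.right⁻¹ (component a i (P.proj p) hp hi) := by
  obtain ⟨i, hi⟩ := T.cover.exists_mem (P.proj p)
  obtain ⟨k, hk⟩ := P.exists_act_eq (T.proj_s i ⟨P.proj p, hi⟩)
  refine ⟨E.actA k.right⁻¹ (component a i (P.proj p) hp hi), fun j hj l hl ↦ ?_⟩
  · have hkl : k = ⟨T.g i j ⟨_, hi, hj⟩, T.ε i j ⟨_, hi, hj⟩⟩ * l := by
      refine P.act_free (p := T.s i ⟨P.proj p, hi⟩) ?_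
      rw [P.act_mul, ← T.transition i j ⟨_, hi, hj⟩, ← hl, ← hk]
    rw [component_eq_actA a i j _ hp hi hj, ← E.actA_mul_left, hkl]
    congr 1
    change (T.ε i j ⟨_, hi, hj⟩ * l.right)⁻¹ * T.ε i j ⟨_, hi, hj⟩ = _
    group

/-- The equivariant function on `P` given by a section of the local system: its pullback by the
local section `s i` is the `i`-th component. -/
def value (a : (localSystem E T.twist).obj (op U)) (p : P.Total) (hp : P.proj p ∈ U) : A :=
  (exists_value T a p hp).choose

lemma value_eq (a : (localSystem E T.twist).obj (op U)) (p : P.Total) (hp : P.proj p ∈ U)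
    (i : T.cover.idx) (hi : P.proj p ∈ T.cover.set i) (k : E.H)
    (hk : p = P.act (T.s i ⟨P.proj p, hi⟩) k) :
    value T a p hp = E.actA k.right⁻¹ (component a i (P.proj p) hp hi) :=
  (exists_value T a p hp).choose_spec i hi k hk

lemma value_of_eq_s (a : (localSystem E T.twist).obj (op U)) {p : P.Total} (hp : P.proj p ∈ U)
    (i : T.cover.idx) {x : X} (hi : x ∈ T.cover.set i) (h : p = T.s i ⟨x, hi⟩) :
    value T a p hp = component a i x (by rw [h, T.proj_s] at hp; exact hp) hi := by
  have hx : P.proj p = x := by rw [h, T.proj_s]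
  subst hx
  rw [value_eq T a p hp i hi 1 (by rw [P.act_one, ← h])]
  simp [E.actA_one_left]

lemma exists_frame (p : P.Total) : ∃ (i : T.cover.idx) (hi : P.proj p ∈ T.cover.set i) (k : E.H),
    p = P.act (T.s i ⟨P.proj p, hi⟩) k := by
  obtain ⟨i, hi⟩ := T.cover.exists_mem (P.proj p)
  obtain ⟨k, hk⟩ := P.exists_act_eq (T.proj_s i ⟨P.proj p, hi⟩)
  exact ⟨i, hi, k, hk⟩

lemma value_act (a : (localSystem E T.twist).obj (op U)) (p : P.Total) (hp : P.proj p ∈ U) (k : E.H)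
    (hpk : P.proj (P.act p k) ∈ U) :
    value T a (P.act p k) hpk = E.actA k.right⁻¹ (value T a p hp) := by
  obtain ⟨i, hi, l, hl⟩ := exists_frame T p
  have hx := P.proj_act p k
  have h1 := value_eq T a (P.act p k) hpk i (by rw [hx]; exact hi) (l * k) (by
    simp only [hx]; rw [P.act_mul, ← hl])
  rw [h1, value_eq T a p hp i hi l hl, ← E.actA_mul_left]
  simp only [hx, SemidirectProduct.mul_right, mul_inv_rev]

lemma value_mul (a b : (localSystem E T.twist).obj (op U)) (p : P.Total) (hp : P.proj p ∈ U) :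
    value T (a * b) p hp = value T a p hp * value T b p hp := by
  obtain ⟨i, hi, l, hl⟩ := exists_frame T p
  rw [value_eq T _ p hp i hi l hl, value_eq T _ p hp i hi l hl, value_eq T _ p hp i hi l hl,
    ← E.actA_mul_right]
  rfl

lemma value_res (h : V ≤ U) (a : (localSystem E T.twist).obj (op U)) (p : P.Total)
    (hp : P.proj p ∈ V) :
    value T (res (localSystem E T.twist) h a) p hp = value T a p (h hp) := by
  obtain ⟨i, hi, l, hl⟩ := exists_frame T p
  rw [value_eq T _ p _ i hi l hl, value_eq T _ p _ i hi l hl]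
  rfl

variable [IsDTopologyCompatible X] [DiffeologicalGroup G]

lemma smooth_value (a : (localSystem E T.twist).obj (op U)) :
    DSmooth fun p : {p // P.proj p ∈ U} ↦ value T a p.1 p.2 := by
  refine dSmooth_of_local (P.smooth_proj.comp dSmooth_val) fun p ↦ ?_
  obtain ⟨i, hi⟩ := T.cover.exists_mem (P.proj p.1)
  refine ⟨T.cover.set i, hi, ?_⟩
  have hk : ∀ q : {q : {p // P.proj p ∈ U} // P.proj q.1 ∈ T.cover.set i}, ∃ k,
      q.1.1 = P.act (T.s i ⟨P.proj q.1.1, q.2⟩) k := fun q ↦ P.exists_act_eq (T.proj_s i _)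
  choose k hk using hk
  have hq : DSmooth fun q : {q : {p // P.proj p ∈ U} // P.proj q.1 ∈ T.cover.set i} ↦ q.1.1 :=
    dSmooth_val.comp dSmooth_val
  have hks : DSmooth k := P.dSmooth_of_act_eq
    ((T.smooth_s i).comp (dSmooth_subtypeMk (P.smooth_proj.comp hq) fun q ↦ q.2)) hq hk
  have : (fun q : {q : {p // P.proj p ∈ U} // P.proj q.1 ∈ T.cover.set i} ↦
      value T a q.1.1 q.1.2) =
      fun q ↦ E.actA (k q).right⁻¹ (component a i (P.proj q.1.1) q.1.2 q.2) :=
    funext fun q ↦ value_eq T a q.1.1 q.1.2 i q.2 (k q) (hk q)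
  change DSmooth (fun q : {q : {p // P.proj p ∈ U} // P.proj q.1 ∈ T.cover.set i} ↦
      value T a q.1.1 q.1.2)
  rw [this]
  exact E.smooth_actA (dSmooth_inv (dSmooth_right.comp hks)) ((smooth_component a i).comp
    (dSmooth_subtypeMk (P.smooth_proj.comp hq) fun q ↦ ⟨q.1.2, q.2⟩))

namespace LocalLift

lemma proj_toBase_mem (L : LocalLift P U) (p : L.bundle.Total) : P.proj (L.toBase p) ∈ U := by
  rw [L.proj_toBase]; exact L.bundle.proj_mem p

variable [DiffeologicalGroup Ghat] (L : LocalLift P U)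

/-- Right multiplication by a function `p ↦ A` is `Ĥ`-equivariant only if the function absorbs the
conjugation in `incl_mul_eq`. The equivariance `value_act` is exactly this condition. -/
lemma exists_section_action (a : (localSystem E T.twist).obj (op U)) : ∃ F : L ⟶ L, ∀ p,
    ev F p = L.bundle.act p (E.incl (value T a (L.toBase p) (L.proj_toBase_mem p))) := by
  refine exists_hom_of_map _ ?_ (fun p k ↦ ?_) fun p ↦ L.toBase_act_incl _ _
  · exact L.bundle.dSmooth_act dSmooth_id (E.smooth_incl.comp ((smooth_value T a).comp
      (dSmooth_subtypeMk L.subduction.1 L.proj_toBase_mem)))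
  · have hm : P.proj (P.act (L.toBase p) (E.π k)) ∈ U := by
      rw [P.proj_act]; exact L.proj_toBase_mem p
    have : value T a (L.toBase (L.bundle.act p k)) (L.proj_toBase_mem _) =
        E.actA k.right⁻¹ (value T a (L.toBase p) (L.proj_toBase_mem p)) := by
      rw [← show (E.π k).right = k.right from rfl, ← value_act T a _ _ _ hm]
      simp only [L.toBase_act]
    rw [this, ← PrincipalBundle.act_mul, ← PrincipalBundle.act_mul, E.incl_mul_eq]

/-- The action of a section of the local system on a lift. -/
def sectionAction (a : (localSystem E T.twist).obj (op U)) : L ⟶ L :=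
  (L.exists_section_action T a).choose

lemma ev_sectionAction (a : (localSystem E T.twist).obj (op U)) (p : L.bundle.Total) :
    ev (L.sectionAction T a) p =
      L.bundle.act p (E.incl (value T a (L.toBase p) (L.proj_toBase_mem p))) :=
  (L.exists_section_action T a).choose_spec p

lemma sectionAction_mul (a b : (localSystem E T.twist).obj (op U)) :
    L.sectionAction T (a * b) = L.sectionAction T b ≫ L.sectionAction T a := by
  -- The second factor sees a point already moved by `A`, but `value` depends only on the image in
  -- `P`, which has not changed.
  refine hom_ext fun p ↦ ?_
  rw [ev_comp, ev_sectionAction, ev_sectionAction, ev_sectionAction, ← PrincipalBundle.act_mul,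
    ← map_mul, value_mul, mul_comm]
  simp only [L.toBase_act_incl]

lemma sectionAction_injective : Function.Injective (L.sectionAction T) := fun a b h ↦ by
  refine section_ext fun i x hU hi ↦ ?_
  have hs : P.proj (T.s i ⟨x, hi⟩) = x := T.proj_s i _
  obtain ⟨p, hp⟩ := L.toBase_surjective (p := T.s i ⟨x, hi⟩) (by rw [hs]; exact hU)
  have h' := congrArg (fun F ↦ ev F p) h
  simp only [ev_sectionAction] at h'
  have h3 := E.incl_injective (L.bundle.act_free h')
  rwa [value_of_eq_s T a _ i hi hp, value_of_eq_s T b _ i hi hp] at h3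

/-- An automorphism preserves `A`-orbits, hence is multiplication by a smooth `c`. Its equivariance
makes `c` twisted-equivariant and constant on `A`-orbits, so `c` descends to `P`, and its values
above the sections `s i` are the components of the required section. -/
lemma sectionAction_surjective : Function.Surjective (L.sectionAction T) := fun F ↦ by
  have hc : ∀ p, ∃ c : A, ev F p = L.bundle.act p (E.incl c) := fun p ↦
    (L.orbit _ _).1 (toBase_ev F p).symm
  choose c hc using hc
  have hcs : DSmooth c :=
    E.smooth_of_incl (L.bundle.dSmooth_of_act_eq dSmooth_id (smooth_ev F) hc)
  have hck : ∀ p k, c (L.bundle.act p k) = E.actA k.right⁻¹ (c p) := fun p k ↦ by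
    refine E.incl_injective (mul_left_cancel (a := k) (L.bundle.act_free (p := p) ?_))
    rw [← E.incl_mul_eq, PrincipalBundle.act_mul, ← hc, ev_act, hc, PrincipalBundle.act_mul]
  have hcb : ∀ p p', L.toBase p = L.toBase p' → c p = c p' := fun p p' h ↦ by
    obtain ⟨a, rfl⟩ := (L.orbit _ _).1 h
    rw [hck]
    exact (E.actA_one_left _).symm
  have hb : ∀ i (x : X) (_ : x ∈ U) (hi : x ∈ T.cover.set i), ∃ p, L.toBase p = T.s i ⟨x, hi⟩ :=
    fun i x hU hi ↦ L.toBase_surjective (by rw [T.proj_s]; exact hU)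
  choose b hb using hb
  have hb₁ (i : T.cover.idx) :
      DSmooth fun y : ↥(U ⊓ T.cover.set i) ↦ c (b i y.1 y.2.1 y.2.2) := fun n y hy ↦ by
    -- The points `b` above `s i` were chosen without regard to smoothness. Locally they can be
    -- replaced by a plot lifting `s i ∘ y`, because `c` only sees the image in `P`.
    refine isPlot_of_eventually_eq fun t ↦ ?_
    obtain ⟨O, hO, ht, p, hp, h⟩ := L.subduction.2.2 n
      (fun t ↦ T.s i ⟨(y t).1, (y t).2.2⟩) (T.smooth_s i n _ hy)
      (fun t ↦ by
        change P.proj (T.s i _) ∈ U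
        rw [T.proj_s]; exact (y t).2.1) t
    exact ⟨O, hO, ht, c ∘ p, hcs n p hp, fun s hs ↦ hcb _ _ ((hb _ _ _ _).trans (h s hs).symm)⟩
  have hb₂ (i j : T.cover.idx) (x : X) (hU : x ∈ U) (hi : x ∈ T.cover.set i)
      (hj : x ∈ T.cover.set j) :
      c (b i x hU hi) = E.actA (T.ε i j ⟨x, hi, hj⟩) (c (b j x hU hj)) := by
    -- Acting by a lift of `h_ij` carries a point above `s i` to one above `s j`; the equivariance
    -- of `c` then yields the gluing rule.
    obtain ⟨k, hk⟩ := E.π_surjective ⟨T.g i j ⟨x, hi, hj⟩, T.ε i j ⟨x, hi, hj⟩⟩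
    have hkr : k.right = T.ε i j ⟨x, hi, hj⟩ := congrArg SemidirectProduct.right hk
    have : c (b j x hU hj) = c (L.bundle.act (b i x hU hi) k) := hcb _ _ (by
      rw [hb, L.toBase_act, hb, hk, ← T.transition i j ⟨x, hi, hj⟩])
    rw [this, hck, hkr, ← E.actA_mul_left, mul_inv_cancel, E.actA_one_left]
  refine ⟨mkSection E (fun i x hU hi ↦ c (b i x hU hi)) hb₁ hb₂, hom_ext fun p ↦ ?_⟩
  rw [ev_sectionAction, hc]
  congr 2
  obtain ⟨i, hi, k, hk⟩ := exists_frame T (L.toBase p)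
  obtain ⟨l, rfl⟩ := E.π_surjective k
  rw [value_eq T _ _ _ i hi _ hk]
  change E.actA l.right⁻¹ (c (b i (P.proj (L.toBase p)) (L.proj_toBase_mem p) hi)) = _
  rw [← hck]
  exact hcb _ _ (by rw [L.toBase_act, hb, ← hk])

lemma comp_sectionAction {L M : LocalLift P U} (f : L ⟶ M)
    (a : (localSystem E T.twist).obj (op U)) :
    L.sectionAction T a ≫ f = f ≫ M.sectionAction T a := by
  refine hom_ext fun p ↦ ?_
  rw [ev_comp, ev_comp, ev_sectionAction, ev_sectionAction, ev_act]
  simp only [toBase_ev]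

lemma sectionAction_restrict (h : V ≤ U) (a : (localSystem E T.twist).obj (op U)) :
    (L.restrict h).sectionAction T (res (localSystem E T.twist) h a) =
      Hom.restrict (L.sectionAction T a) h := by
  refine hom_ext fun p ↦ (ev_sectionAction T _ _ _).trans (Subtype.ext ?_)
  refine Eq.trans ?_ (ev_sectionAction T L a p.1).symm
  change L.bundle.act _ _ = _
  rw [value_res]
  rfl

/-- The isomorphism between sections of the local system and automorphisms of a lift. -/
def sectionsEquivAut : (localSystem E T.twist).obj (op U) ≃* Aut L :=
  MulEquiv.mk' ((Equiv.ofBijective _ ⟨L.sectionAction_injective T,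
    L.sectionAction_surjective T⟩).trans (Groupoid.isoEquivHom L L).symm)
    fun a b ↦ Iso.ext (L.sectionAction_mul T a b)

end LocalLift

open LocalLift in
/-- The canonical banding of the lifting gerbe. -/
def canonicalBanding [DiffeologicalGroup Ghat] :
    Banding (liftingGerbe P) (localSystem E T.twist) where
  isSheaf := localSystem_isSheaf _
  iso {U} L := sectionsEquivAut (U := U) T L
  naturality {U L M} f a := comp_sectionAction (U := U) (L := L) (M := M) T f a
  restrict {U _} h L a := sectionAction_restrict (U := U) T L h a

theorem isCanonicalBanding_canonicalBanding [DiffeologicalGroup Ghat] :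
    IsCanonicalBanding T (canonicalBanding T) := by
  intro U L a i p hi hp
  refine (L.ev_sectionAction T a p).trans ?_
  rw [value_of_eq_s T a _ i hi hp]

end Automorphisms

/-! ### The class of a banded gerbe -/

section GerbeClass

open Pseudofunctor LocallyDiscreteOpToCat

variable {X : Type u} [TopologicalSpace X]
  {𝒢 : Pseudofunctor (LocallyDiscrete (Opens X)ᵒᵖ) Cat.{v', u'}}

/-- The restriction of a morphism between restrictions of objects of `𝒢`. -/
def resHom {U₁ U₂ V W : Opens X} {x : Sec 𝒢 U₁} {y : Sec 𝒢 U₂} {h₁ : V ≤ U₁} {h₂ : V ≤ U₂}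
    (φ : (resF 𝒢 h₁).obj x ⟶ (resF 𝒢 h₂).obj y) (h : W ≤ V) :
    (resF 𝒢 (h.trans h₁)).obj x ⟶ (resF 𝒢 (h.trans h₂)).obj y :=
  pullHom (F := 𝒢) (f₁ := homOfLE h₁) (f₂ := homOfLE h₂) φ (homOfLE h) (homOfLE (h.trans h₁))
    (homOfLE (h.trans h₂))

section

variable {U₁ U₂ U₃ V W : Opens X} {x : Sec 𝒢 U₁} {y : Sec 𝒢 U₂} {z : Sec 𝒢 U₃}
  {h₁ : V ≤ U₁} {h₂ : V ≤ U₂} {h₃ : V ≤ U₃}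

lemma resHom_comp (φ : (resF 𝒢 h₁).obj x ⟶ (resF 𝒢 h₂).obj y)
    (ψ : (resF 𝒢 h₂).obj y ⟶ (resF 𝒢 h₃).obj z) (h : W ≤ V) :
    resHom (φ ≫ ψ) h = resHom φ h ≫ resHom ψ h := by
  simp only [resHom, pullHom, Functor.map_comp, Category.assoc,
    Cat.Hom.inv_hom_id_toNatTrans_app_assoc]

lemma resHom_resHom (φ : (resF 𝒢 h₁).obj x ⟶ (resF 𝒢 h₂).obj y) (h : W ≤ V) {W' : Opens X}
    (h' : W' ≤ W) : resHom (resHom φ h) h' = resHom φ (h'.trans h) := by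
  rw [resHom, resHom, pullHom_pullHom]
  rfl

variable {F : (Opens X)ᵒᵖ ⥤ CommGrpCat.{u}} (θ : Banding 𝒢 F)

lemma Banding.iso_mul_hom {U : Opens X} (x : Sec 𝒢 U) (a b : F.obj (op U)) :
    (θ.iso x (a * b)).hom = (θ.iso x b).hom ≫ (θ.iso x a).hom := by
  rw [map_mul]
  rfl

lemma Banding.iso_hom_injective {U : Opens X} (x : Sec 𝒢 U) {a b : F.obj (op U)}
    (h : (θ.iso x a).hom = (θ.iso x b).hom) : a = b :=
  (θ.iso x).injective (Iso.ext h)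

lemma Banding.exists_iso_hom {U : Opens X} (x : Sec 𝒢 U) (φ : x ⟶ x) [IsIso φ] :
    ∃ a, (θ.iso x a).hom = φ := by
  obtain ⟨a, ha⟩ := (θ.iso x).surjective (asIso φ)
  exact ⟨a, by rw [ha]; rfl⟩

/-- `resHom` is the restriction functor conjugated by a coherence isomorphism `e`. The banding
commutes with the functor, and naturality along `e` removes the conjugation. -/
lemma Banding.resHom_iso (h : W ≤ V) (a : F.obj (op V)) :
    resHom (θ.iso ((resF 𝒢 h₁).obj x) a).hom h =
      (θ.iso ((resF 𝒢 (h.trans h₁)).obj x) (res F h a)).hom := by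
  let e := 𝒢.mapComp' (homOfLE h₁).op.toLoc (homOfLE h).op.toLoc (homOfLE (h.trans h₁)).op.toLoc rfl
  have hθ := θ.naturality (x := (resF 𝒢 h).obj ((resF 𝒢 h₁).obj x))
    (y := (resF 𝒢 (h.trans h₁)).obj x) (e.inv.toNatTrans.app x) (res F h a)
  rw [θ.restrict] at hθ
  exact (congrArg (fun k ↦ e.hom.toNatTrans.app x ≫ k) hθ).trans
    (Cat.Hom.hom_inv_id_toNatTrans_app_assoc e x _)

end

namespace GerbeChoice

variable (D : GerbeChoice 𝒢) {F : (Opens X)ᵒᵖ ⥤ CommGrpCat.{u}} {θ : Banding 𝒢 F}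

lemma resHom_fRes (i j) {W W' : Opens X} (hi : W ≤ D.cover.set i) (hj : W ≤ D.cover.set j)
    (h : W' ≤ W) : resHom (D.fRes i j hi hj) h = D.fRes i j (h.trans hi) (h.trans hj) := by
  rw [resHom, fRes, pullHom_pullHom]
  rfl

variable {D} in
lemma HasCochain.fRes_comp {c : D.cover.C2 F} (hc : D.HasCochain θ c) (i j k) {W : Opens X}
    (hW : W ≤ D.cover.inter₃ i j k) (hi : W ≤ D.cover.set i) (hj : W ≤ D.cover.set j)
    (hk : W ≤ D.cover.set k) :
    D.fRes j k hj hk ≫ D.fRes i j hi hj =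
      D.fRes i k hi hk ≫ (θ.iso ((resF 𝒢 hi).obj (D.x i)) (res F hW (c i j k))).hom := by
  have := congrArg (fun φ ↦ resHom φ hW) (hc i j k)
  simp only [resHom_comp, resHom_fRes, Banding.resHom_iso] at this
  exact this.symm

lemma exists_hasCochain (h𝒢 : IsGerbe 𝒢) (θ : Banding 𝒢 F) : ∃ c, D.HasCochain θ c := by
  have (i j k : D.cover.idx) (hi : D.cover.inter₃ i j k ≤ D.cover.set i)
      (hj : D.cover.inter₃ i j k ≤ D.cover.set j) (hk : D.cover.inter₃ i j k ≤ D.cover.set k) :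
      ∃ a, D.fRes i k hi hk ≫ (θ.iso ((resF 𝒢 hi).obj (D.x i)) a).hom =
        D.fRes j k hj hk ≫ D.fRes i j hi hj := by
    have h1 := h𝒢.isIso _ _ _ (D.fRes i k hi hk)
    have h2 := h𝒢.isIso _ _ _ (inv (D.fRes i k hi hk) ≫ D.fRes j k hj hk ≫ D.fRes i j hi hj)
    obtain ⟨a, ha⟩ := θ.exists_iso_hom _
      (inv (D.fRes i k hi hk) ≫ D.fRes j k hj hk ≫ D.fRes i j hi hj)
    exact ⟨a, by rw [ha, IsIso.hom_inv_id_assoc]⟩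
  choose c hc using this
  exact ⟨fun i j k ↦ c i j k _ _ _, fun i j k ↦ hc i j k _ _ _⟩

variable {D} in
/-- The cochain of a choice of local objects and isomorphisms is a cocycle. -/
theorem HasCochain.mem_Z2 (h𝒢 : IsGerbe 𝒢) {c : D.cover.C2 F} (hc : D.HasCochain θ c) :
    c ∈ D.cover.Z2 F := by
  rw [MonoidHom.mem_ker]
  funext i j k l
  have hi : D.cover.inter₄ i j k l ≤ D.cover.set i := fun _ h ↦ h.1.1.1
  have hj : D.cover.inter₄ i j k l ≤ D.cover.set j := fun _ h ↦ h.1.1.2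
  have hk : D.cover.inter₄ i j k l ≤ D.cover.set k := fun _ h ↦ h.1.2
  have hl : D.cover.inter₄ i j k l ≤ D.cover.set l := fun _ h ↦ h.2
  have := h𝒢.isIso _ _ _ (D.fRes i l hi hl)
  -- Both sides, precomposed with `f_il`, equal the composite of `f_kl`, `f_jk` and `f_ij`,
  -- bracketed in two ways. On the right, naturality of the banding moves the action of `c_jkl` from
  -- `x_i` to `x_j`, past `f_ij`.
  have key : res F (D.cover.le_ijk i j k l) (c i j k) * res F (D.cover.le_ikl i j k l) (c i k l) =
      res F (D.cover.le_jkl i j k l) (c j k l) * res F (D.cover.le_ijl i j k l) (c i j l) := by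
    refine θ.iso_hom_injective ((resF 𝒢 hi).obj (D.x i)) ?_
    rw [θ.iso_mul_hom, θ.iso_mul_hom, ← cancel_epi (D.fRes i l hi hl), ← Category.assoc,
      ← Category.assoc, ← hc.fRes_comp i k l _ hi hk hl, ← hc.fRes_comp i j l _ hi hj hl,
      Category.assoc, Category.assoc, ← hc.fRes_comp i j k _ hi hj hk, ← θ.naturality,
      ← Category.assoc, ← Category.assoc, ← hc.fRes_comp j k l _ hj hk hl]
  change res F (D.cover.le_jkl i j k l) (c j k l) * (res F (D.cover.le_ikl i j k l) (c i k l))⁻¹ *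
    res F (D.cover.le_ijl i j k l) (c i j l) * (res F (D.cover.le_ijk i j k l) (c i j k))⁻¹ = 1
  rw [mul_right_comm (res F _ (c j k l)), ← key, mul_inv_cancel_right, mul_inv_cancel]

/-- Two choices of local objects become isomorphic over a common refinement of the covers. -/
lemma exists_refinement (h𝒢 : IsGerbe 𝒢) (D D' : GerbeChoice 𝒢) :
    ∃ (𝒲 : Cover X) (r : Cover.Refines 𝒲 D.cover) (t : Cover.Refines 𝒲 D'.cover),
      Nonempty (∀ w, (resF 𝒢 (r.le w)).obj (D.x (r.idx w)) ⟶
        (resF 𝒢 (t.le w)).obj (D'.x (t.idx w))) := by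
  have hx (x : X) : ∃ (W : Opens X) (i : D.cover.idx) (j : D'.cover.idx) (hi : W ≤ D.cover.set i)
      (hj : W ≤ D'.cover.set j), x ∈ W ∧
        Nonempty ((resF 𝒢 hi).obj (D.x i) ⟶ (resF 𝒢 hj).obj (D'.x j)) := by
    obtain ⟨i, hi⟩ := D.cover.exists_mem x
    obtain ⟨j, hj⟩ := D'.cover.exists_mem x
    obtain ⟨W, hW, hxW, ⟨φ⟩⟩ := h𝒢.locally_connected (D.cover.set i ⊓ D'.cover.set j)
      ((resF 𝒢 inf_le_left).obj (D.x i)) ((resF 𝒢 inf_le_right).obj (D'.x j)) x ⟨hi, hj⟩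
    refine ⟨W, i, j, hW.trans inf_le_left, hW.trans inf_le_right, hxW, ⟨?_⟩⟩
    exact (𝒢.mapComp' (homOfLE inf_le_left).op.toLoc (homOfLE hW).op.toLoc
      (homOfLE (hW.trans inf_le_left)).op.toLoc rfl).hom.toNatTrans.app _ ≫ φ.hom ≫
      (𝒢.mapComp' (homOfLE inf_le_right).op.toLoc (homOfLE hW).op.toLoc
        (homOfLE (hW.trans inf_le_right)).op.toLoc rfl).inv.toNatTrans.app _
  choose W i j hi hj hxW φ using hx
  -- The refinement is indexed by the points of `X`, one neighbourhood for each.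
  exact ⟨⟨X, W, eq_top_iff.2 fun x _ ↦ Opens.mem_iSup.2 ⟨x, hxW x⟩⟩, ⟨i, hi⟩, ⟨j, hj⟩,
    ⟨fun x ↦ (φ x).some⟩⟩

/-- The class of the cochain does not depend on the choices. -/
theorem HasCochain.cechRel (h𝒢 : IsGerbe 𝒢) {D D' : GerbeChoice 𝒢} {c : D.cover.Z2 F}
    {c' : D'.cover.Z2 F} (hc : D.HasCochain θ c.1) (hc' : D'.HasCochain θ c'.1) :
    CechRel F ⟨D'.cover, c'⟩ ⟨D.cover, c⟩ := by
  obtain ⟨𝒲, r, t, ⟨φ⟩⟩ := exists_refinement h𝒢 D D'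
  refine ⟨𝒲, t, r, ?_⟩
  -- The section `b` measures the failure of the local isomorphisms `φ` to intertwine the two
  -- families `f` and `f'`; it is the cochain whose coboundary is the difference.
  have hb (x y : 𝒲.idx) : ∃ b, D.fRes (r.idx x) (r.idx y) (inf_le_left.trans (r.le x))
      (inf_le_right.trans (r.le y)) ≫ resHom (φ x) (inf_le_left : 𝒲.inter₂ x y ≤ _) ≫
        (θ.iso ((resF 𝒢 _).obj (D'.x (t.idx x))) b).hom =
      resHom (φ y) (inf_le_right : 𝒲.inter₂ x y ≤ _) ≫
        D'.fRes (t.idx x) (t.idx y) (inf_le_left.trans (t.le x)) (inf_le_right.trans (t.le y)) := by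
    have h1 := h𝒢.isIso _ _ _ (D.fRes (r.idx x) (r.idx y)
      ((inf_le_left : 𝒲.inter₂ x y ≤ _).trans (r.le x)) (inf_le_right.trans (r.le y)) ≫
        resHom (φ x) inf_le_left)
    have h2 := h𝒢.isIso _ _ _ (resHom (φ y) (inf_le_right : 𝒲.inter₂ x y ≤ _) ≫
      D'.fRes (t.idx x) (t.idx y) (inf_le_left.trans (t.le x)) (inf_le_right.trans (t.le y)))
    obtain ⟨b, hb⟩ := θ.exists_iso_hom _ (inv (D.fRes (r.idx x) (r.idx y)
      ((inf_le_left : 𝒲.inter₂ x y ≤ _).trans (r.le x)) (inf_le_right.trans (r.le y)) ≫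
        resHom (φ x) inf_le_left) ≫ resHom (φ y) (inf_le_right : 𝒲.inter₂ x y ≤ _) ≫
      D'.fRes (t.idx x) (t.idx y) (inf_le_left.trans (t.le x)) (inf_le_right.trans (t.le y)))
    exact ⟨b, by rw [hb, ← Category.assoc, IsIso.hom_inv_id_assoc]⟩
  choose b hb using hb
  have hbW (x y : 𝒲.idx) {W : Opens X} (hW : W ≤ 𝒲.inter₂ x y) (hx : W ≤ 𝒲.set x)
      (hy : W ≤ 𝒲.set y) : D.fRes (r.idx x) (r.idx y) (hx.trans (r.le x)) (hy.trans (r.le y)) ≫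
        resHom (φ x) hx ≫
          (θ.iso ((resF 𝒢 (hx.trans (t.le x))).obj (D'.x (t.idx x))) (res F hW (b x y))).hom =
      resHom (φ y) hy ≫
        D'.fRes (t.idx x) (t.idx y) (hx.trans (t.le x)) (hy.trans (t.le y)) := by
    have := congrArg (fun ψ ↦ resHom ψ hW) (hb x y)
    simp only [resHom_comp, resHom_fRes, Banding.resHom_iso, resHom_resHom] at this
    exact this
  refine ⟨b, ?_⟩
  funext x y z
  have hx : 𝒲.inter₃ x y z ≤ 𝒲.set x := fun _ h ↦ h.1.1
  have hy : 𝒲.inter₃ x y z ≤ 𝒲.set y := fun _ h ↦ h.1.2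
  have hz : 𝒲.inter₃ x y z ≤ 𝒲.set z := fun _ h ↦ h.2
  have hr : 𝒲.inter₃ x y z ≤ D.cover.inter₃ (r.idx x) (r.idx y) (r.idx z) :=
    inf_le_inf (inf_le_inf (r.le x) (r.le y)) (r.le z)
  have ht : 𝒲.inter₃ x y z ≤ D'.cover.inter₃ (t.idx x) (t.idx y) (t.idx z) :=
    inf_le_inf (inf_le_inf (t.le x) (t.le y)) (t.le z)
  have := h𝒢.isIso _ _ _ (D.fRes (r.idx x) (r.idx z) (hx.trans (r.le x)) (hz.trans (r.le z)) ≫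
    resHom (φ x) hx)
  -- Both sides evaluate `φ_z` followed by `f'_yz` and `f'_xy`: either the `f'` are composed first,
  -- producing `c'` and `b_xz`, or `φ` is moved past them one at a time, producing `b_yz`, `b_xy`
  -- and `c`.
  have key : res F ht (c'.1 (t.idx x) (t.idx y) (t.idx z)) * res F (𝒲.le_ik x y z) (b x z) =
      res F (𝒲.le_jk x y z) (b y z) * res F (𝒲.le_ij x y z) (b x y) *
        res F hr (c.1 (r.idx x) (r.idx y) (r.idx z)) := by
    refine θ.iso_hom_injective ((resF 𝒢 (hx.trans (t.le x))).obj (D'.x (t.idx x))) ?_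
    rw [← cancel_epi (D.fRes (r.idx x) (r.idx z) (hx.trans (r.le x)) (hz.trans (r.le z)) ≫
      resHom (φ x) hx), θ.iso_mul_hom, θ.iso_mul_hom, θ.iso_mul_hom]
    have e1 := hbW x z (𝒲.le_ik x y z) hx hz
    have e2 := hbW x y (𝒲.le_ij x y z) hx hy
    have e3 := hbW y z (𝒲.le_jk x y z) hy hz
    have f1 := hc.fRes_comp (r.idx x) (r.idx y) (r.idx z) hr (hx.trans (r.le x))
      (hy.trans (r.le y)) (hz.trans (r.le z))
    have f2 := hc'.fRes_comp (t.idx x) (t.idx y) (t.idx z) ht (hx.trans (t.le x))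
      (hy.trans (t.le y)) (hz.trans (t.le z))
    trans resHom (φ z) hz ≫ D'.fRes (t.idx y) (t.idx z) (hy.trans (t.le y)) (hz.trans (t.le z)) ≫
      D'.fRes (t.idx x) (t.idx y) (hx.trans (t.le x)) (hy.trans (t.le y))
    · rw [f2, ← Category.assoc (resHom (φ z) hz), ← e1]
      simp only [Category.assoc]
    · rw [← Category.assoc, ← e3, Category.assoc, Category.assoc, θ.naturality,
        ← Category.assoc (resHom (φ y) hy), ← e2]
      simp only [Category.assoc]
      rw [← Category.assoc, f1, Category.assoc, ← Category.assoc (θ.iso _ _).hom, θ.naturality]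
      simp only [Category.assoc]
  change res F (𝒲.le_jk x y z) (b y z) * (res F (𝒲.le_ik x y z) (b x z))⁻¹ *
    res F (𝒲.le_ij x y z) (b x y) = res F ht (c'.1 (t.idx x) (t.idx y) (t.idx z)) /
      res F hr (c.1 (r.idx x) (r.idx y) (r.idx z))
  rw [eq_div_iff_mul_eq', mul_right_comm (res F _ (b y z)),
    mul_right_comm _ _ (res F hr _), ← key, mul_inv_cancel_right]

end GerbeChoice

theorem isGerbeClass_of_hasCochain (h𝒢 : IsGerbe 𝒢) {F : (Opens X)ᵒᵖ ⥤ CommGrpCat.{u}}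
    {θ : Banding 𝒢 F} {D : GerbeChoice 𝒢} {c : D.cover.Z2 F} (hc : D.HasCochain θ c.1) :
    IsGerbeClass θ (CechH2.mk c) := by
  refine ⟨⟨D⟩, fun D' ↦ ?_⟩
  obtain ⟨c', hc'⟩ := D'.exists_hasCochain h𝒢 θ
  exact ⟨⟨c', hc'.mem_Z2 h𝒢⟩, hc',
    Quot.sound (hc.cechRel (c' := ⟨c', hc'.mem_Z2 h𝒢⟩) h𝒢 hc')⟩

end GerbeClass

/-! ### The obstruction cocycle -/

section Obstruction

open LocalLift

variable {X : Type u} [TopologicalSpace X] [DiffeologicalSpace X] [IsDTopologyCompatible X]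
  {A Ghat G : Type u} [CommGroup A] [Group Ghat] [Group G]
  [DiffeologicalSpace A] [DiffeologicalSpace Ghat] [DiffeologicalSpace G]
  [DiffeologicalGroup A] [DiffeologicalGroup Ghat] [DiffeologicalGroup G]
  {E : TwistedCentralExtension A Ghat G} {P : PrincipalBundle E.H (⊤ : Opens X)}
  {T : Trivialization P}

/-- The lift `ĥ i j = (ĝ i j, ε i j)` of the transition function `h i j`. -/
def Trivialization.Lifts.h (l : T.Lifts) (i j : T.cover.idx)
    (y : ↥(T.cover.set i ⊓ T.cover.set j)) : E.Hhat := ⟨l.g i j y, T.ε i j y⟩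

/-- The `G`-component of the cocycle identity for `h_ij` puts the expression in the kernel of `q`.
It is smooth into `A` because `ι` is an induction, and since `U_ijk ≤ U_i` it extends from the
`i`-th frame to a section of `A_α`. -/
lemma exists_obstructionCochain (l : T.Lifts) :
    ∃ c : T.cover.C2 (localSystem E T.twist), IsObstructionCochain T l c := by
  have (i j k : T.cover.idx) : ∃ a : (localSystem E T.twist).obj (op (T.cover.inter₃ i j k)),
      ∀ (x : X) (hi : x ∈ T.cover.set i) (hj : x ∈ T.cover.set j) (hk : x ∈ T.cover.set k),
        E.ι (component a i x ⟨⟨hi, hj⟩, hk⟩ hi) =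
          l.g i j ⟨x, hi, hj⟩ * E.σhat (T.ε i j ⟨x, hi, hj⟩) (l.g j k ⟨x, hj, hk⟩) *
            (l.g i k ⟨x, hi, hk⟩)⁻¹ := by
    have hb (y : ↥(T.cover.inter₃ i j k)) : ∃ a : A, E.ι a =
        l.g i j ⟨y.1, y.2.1⟩ * E.σhat (T.ε i j ⟨y.1, y.2.1⟩) (l.g j k ⟨y.1, y.2.1.2, y.2.2⟩) *
            (l.g i k ⟨y.1, y.2.1.1, y.2.2⟩)⁻¹ := by
      refine E.exists_ι_of_q ?_
      rw [map_mul, map_mul, map_inv, E.q_σhat, l.lifts, l.lifts, l.lifts, mul_inv_eq_one]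
      exact congrArg SemidirectProduct.left (T.cocycle i j k y.1 y.2.1.1 y.2.1.2 y.2.2)
    choose b hb using hb
    have hbs : DSmooth b := by
      refine E.smooth_of_ι ?_
      simp only [hb]
      have hij : DSmooth fun y : ↥(T.cover.inter₃ i j k) ↦
          (⟨y.1, y.2.1⟩ : ↥(T.cover.set i ⊓ T.cover.set j)) := dSmooth_subtypeMk dSmooth_val _
      have hjk : DSmooth fun y : ↥(T.cover.inter₃ i j k) ↦
          (⟨y.1, y.2.1.2, y.2.2⟩ : ↥(T.cover.set j ⊓ T.cover.set k)) :=
        dSmooth_subtypeMk dSmooth_val _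
      have hik : DSmooth fun y : ↥(T.cover.inter₃ i j k) ↦
          (⟨y.1, y.2.1.1, y.2.2⟩ : ↥(T.cover.set i ⊓ T.cover.set k)) :=
        dSmooth_subtypeMk dSmooth_val _
      exact dSmooth_mul (dSmooth_mul ((l.smooth_g i j).comp hij)
        (dSmooth_uncurry_units (f := fun ε x ↦ E.σhat ε x) E.smooth_σhat
          ((T.smooth_ε i j).comp hij) ((l.smooth_g j k).comp hjk)))
        (dSmooth_inv ((l.smooth_g i k).comp hik))
    obtain ⟨a, ha⟩ := exists_section_component_eq (E := E) (z := T.twist) (i := i)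
      (fun x (hx : x ∈ T.cover.inter₃ i j k) ↦ hx.1.1) b hbs
    exact ⟨a, fun x hi hj hk ↦ (congrArg E.ι (ha x ⟨⟨hi, hj⟩, hk⟩)).trans (hb _)⟩
  choose c hc using this
  exact ⟨c, fun i j k x hi hj hk ↦ hc i j k x hi hj hk⟩

/-- The factor `σhat (ε_ij)` in the definition of `a_ijk` is the twist of multiplication in `Ĥ`, so
the formula becomes `a_ijk ĥ_ik = ĥ_ij ĥ_jk`. -/
lemma IsObstructionCochain.incl_mul {l : T.Lifts} {c : T.cover.C2 (localSystem E T.twist)}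
    (hc : IsObstructionCochain T l c) (i j k : T.cover.idx) (x : X) (hi : x ∈ T.cover.set i)
    (hj : x ∈ T.cover.set j) (hk : x ∈ T.cover.set k) :
    E.incl (component (c i j k) i x ⟨⟨hi, hj⟩, hk⟩ hi) * l.h i k ⟨x, hi, hk⟩ =
      l.h i j ⟨x, hi, hj⟩ * l.h j k ⟨x, hj, hk⟩ := by
  refine SemidirectProduct.ext ?_ ?_
  · change E.ι _ * E.σhat 1 (l.g i k ⟨x, hi, hk⟩) =
      l.g i j ⟨x, hi, hj⟩ * E.σhat (T.ε i j ⟨x, hi, hj⟩) (l.g j k ⟨x, hj, hk⟩)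
    rw [hc i j k x hi hj hk, map_one, MulAut.one_apply, inv_mul_cancel_right]
  · change 1 * T.ε i k ⟨x, hi, hk⟩ = T.ε i j ⟨x, hi, hj⟩ * T.ε j k ⟨x, hj, hk⟩
    rw [one_mul]
    exact (congrArg SemidirectProduct.right (T.cocycle i j k x hi hj hk)).symm

variable (T) in
/-- The trivial lift over a member of the cover. -/
def frameLift (i : T.cover.idx) : LocalLift P (T.cover.set i) :=
  trivialLift (T.s i) (T.smooth_s i) (T.proj_s i)

variable (T) in
/-- The canonical section of the trivial lift. -/
def frameLiftSection (i : T.cover.idx) (y : T.cover.set i) : (frameLift T i).bundle.Total := (y, 1)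

lemma smooth_frameLiftSection (i : T.cover.idx) : DSmooth (frameLiftSection T i) :=
  dSmooth_prodMk dSmooth_id dSmooth_const

lemma toBase_frameLiftSection (i : T.cover.idx) (y : T.cover.set i) :
    (frameLift T i).toBase (frameLiftSection T i y) = T.s i y :=
  (congrArg (P.act (T.s i y)) (map_one E.π)).trans (P.act_one _)

lemma exists_frameLift_hom (l : T.Lifts) (i j : T.cover.idx) :
    ∃ F : (frameLift T j).restrict (inf_le_right : T.cover.inter₂ i j ≤ _) ⟶
      (frameLift T i).restrict inf_le_left, ∀ y,
        (ev F ⟨frameLiftSection T j ⟨y.1, y.2.2⟩, y.2⟩).1 =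
          (frameLift T i).bundle.act (frameLiftSection T i ⟨y.1, y.2.1⟩) (l.h i j y) := by
  have hp (y : ↥(T.cover.inter₂ i j)) : (frameLift T i).bundle.proj ((frameLift T i).bundle.act
      (frameLiftSection T i ⟨y.1, y.2.1⟩) (l.h i j y)) ∈ T.cover.inter₂ i j := by
    rw [PrincipalBundle.proj_act]; exact y.2
  have hh : DSmooth (l.h i j) := dSmooth_semidirectMk (l.smooth_g i j) (T.smooth_ε i j)
  obtain ⟨F, hF⟩ := exists_hom_of_sections
    (L := (frameLift T j).restrict (inf_le_right : T.cover.inter₂ i j ≤ _))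
    (M := (frameLift T i).restrict inf_le_left)
    (fun y ↦ ⟨frameLiftSection T j ⟨y.1, y.2.2⟩, y.2⟩)
    (fun y ↦ ⟨(frameLift T i).bundle.act (frameLiftSection T i ⟨y.1, y.2.1⟩) (l.h i j y), hp y⟩)
    (dSmooth_subtypeMk ((smooth_frameLiftSection j).comp (dSmooth_subtypeMk dSmooth_val _)) _)
    (dSmooth_subtypeMk ((frameLift T i).bundle.dSmooth_act
      ((smooth_frameLiftSection i).comp (dSmooth_subtypeMk dSmooth_val _)) hh) _)
    (fun _ ↦ rfl) (fun y ↦ by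
      change (frameLift T j).toBase _ = (frameLift T i).toBase _
      rw [toBase_act, toBase_frameLiftSection, toBase_frameLiftSection, T.transition i j y,
        Trivialization.Lifts.h, E.π_mk, l.lifts])
  exact ⟨F, fun y ↦ congrArg Subtype.val (hF y)⟩

/-- The trivial lifts over the members of the cover, with the isomorphisms given by lifts of the
transition functions. -/
def gerbeChoice (l : T.Lifts) : GerbeChoice (liftingGerbe P) where
  cover := T.cover
  x i := frameLift T i
  f i j := (Groupoid.isoEquivHom ((frameLift T j).restrict (inf_le_right : T.cover.inter₂ i j ≤ _))
    ((frameLift T i).restrict inf_le_left)).symm (exists_frameLift_hom l i j).choose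

lemma gerbeChoice_fRes (l : T.Lifts) (i j : T.cover.idx) {W : Opens X} (hi : W ≤ T.cover.set i)
    (hj : W ≤ T.cover.set j) (x : X) (hx : x ∈ W) (p : ((frameLift T j).restrict hj).bundle.Total)
    (k : E.Hhat)
    (hp : p.1 = (frameLift T j).bundle.act (frameLiftSection T j ⟨x, hj hx⟩) k) :
    (ev (L := (frameLift T j).restrict hj) (M := (frameLift T i).restrict hi)
      ((gerbeChoice l).fRes i j hi hj) p).1 =
        (frameLift T i).bundle.act (frameLiftSection T i ⟨x, hi hx⟩)
          (l.h i j ⟨x, hi hx, hj hx⟩ * k) := by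
  refine (liftingGerbe_pullHom (f₁ := homOfLE inf_le_right) (f₂ := homOfLE inf_le_left)
    (exists_frameLift_hom l i j).choose (homOfLE (le_inf hi hj)) (homOfLE hj) (homOfLE hi)
    rfl rfl p).trans ?_
  have hF := (exists_frameLift_hom l i j).choose_spec ⟨x, hi hx, hj hx⟩
  rw [PrincipalBundle.act_mul, ← hF]
  refine Eq.trans ?_ (congrArg Subtype.val (ev_act (exists_frameLift_hom l i j).choose
    ⟨frameLiftSection T j ⟨x, hj hx⟩, hi hx, hj hx⟩ k))
  exact congrArg (fun z ↦ (ev (exists_frameLift_hom l i j).choose z).1) (Subtype.ext hp)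

/-- At the frame point `q` above `s i`, the section acts by its `i`-th component, hence it sends `q
· ĥ_ik` to `q · a_ijk ĥ_ik = q · ĥ_ij ĥ_jk`. The factors `1` match the form produced by
`gerbeChoice_fRes` at `k = 1`. -/
lemma IsObstructionCochain.ev_sectionAction_frameLift {l : T.Lifts}
    {c : T.cover.C2 (localSystem E T.twist)} (hc : IsObstructionCochain T l c) (i j k : T.cover.idx)
    (hi : T.cover.inter₃ i j k ≤ T.cover.set i) (x : X) (hx : x ∈ T.cover.inter₃ i j k)
    (q : ((frameLift T i).restrict hi).bundle.Total)
    (hq : q.1 = frameLiftSection T i ⟨x, hi hx⟩) :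
    (ev (sectionAction T ((frameLift T i).restrict hi) (c i j k))
      (((frameLift T i).restrict hi).bundle.act q (l.h i k ⟨x, hx.1.1, hx.2⟩ * 1))).1 =
        (frameLift T i).bundle.act (frameLiftSection T i ⟨x, hi hx⟩)
          (l.h i j ⟨x, hx.1.1, hx.1.2⟩ * (l.h j k ⟨x, hx.1.2, hx.2⟩ * 1)) := by
  have hv := value_of_eq_s T (c i j k) (((frameLift T i).restrict hi).proj_toBase_mem q) i (hi hx)
    ((congrArg (frameLift T i).toBase hq).trans (toBase_frameLiftSection i ⟨x, hi hx⟩))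
  have h₁ := congrArg Subtype.val
    (ev_act (sectionAction T ((frameLift T i).restrict hi) (c i j k)) q
      (l.h i k ⟨x, hx.1.1, hx.2⟩ * 1))
  refine h₁.trans ?_
  have h₂ := (ev_sectionAction T ((frameLift T i).restrict hi) (c i j k) q).trans
    (congrArg (fun b ↦ ((frameLift T i).restrict hi).bundle.act q (E.incl b)) hv)
  refine (congrArg (fun z : ((frameLift T i).restrict hi).bundle.Total ↦ (frameLift T i).bundle.act z.1
    (l.h i k ⟨x, hx.1.1, hx.2⟩ * 1)) h₂).trans ?_
  refine (congrArg (fun z ↦ (frameLift T i).bundle.act ((frameLift T i).bundle.act z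
    (E.incl (component (c i j k) i x hx (hi hx)))) (l.h i k ⟨x, hx.1.1, hx.2⟩ * 1)) hq).trans ?_
  rw [← PrincipalBundle.act_mul, ← mul_assoc, hc.incl_mul i j k x hx.1.1 hx.1.2 hx.2, mul_assoc]

/-- By equivariance it suffices to test one point above each `x`, the frame point of index `k`. Both
composites send it to the `i`-th frame point times `ĥ_ij ĥ_jk`. -/
lemma IsObstructionCochain.hasCochain {l : T.Lifts} {c : T.cover.C2 (localSystem E T.twist)}
    (hc : IsObstructionCochain T l c) : (gerbeChoice l).HasCochain (canonicalBanding T) c := by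
  intro i j k hi hj hk
  refine hom_ext_of_section (L := (frameLift T k).restrict hk) (M := (frameLift T i).restrict hi)
    fun x hx ↦ ⟨⟨frameLiftSection T k ⟨x, hk hx⟩, hx⟩, rfl, Subtype.ext ?_⟩
  have e1 := gerbeChoice_fRes l i k hi hk x hx ⟨frameLiftSection T k ⟨x, hk hx⟩, hx⟩ 1
    (PrincipalBundle.act_one _ _).symm
  have e2 := gerbeChoice_fRes l j k hj hk x hx ⟨frameLiftSection T k ⟨x, hk hx⟩, hx⟩ 1
    (PrincipalBundle.act_one _ _).symm
  have e3 := gerbeChoice_fRes l i j hi hj x hx _ _ e2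
  refine Eq.trans ?_ e3.symm
  let q : ((frameLift T i).restrict hi).bundle.Total :=
    ⟨frameLiftSection T i ⟨x, hi hx⟩, hx⟩
  have e4 : ev (L := (frameLift T k).restrict hk) (M := (frameLift T i).restrict hi)
      ((gerbeChoice l).fRes i k hi hk) ⟨frameLiftSection T k ⟨x, hk hx⟩, hx⟩ =
      ((frameLift T i).restrict hi).bundle.act q (l.h i k ⟨x, hi hx, hk hx⟩ * 1) := Subtype.ext e1
  have e5 := congrArg (fun z ↦ (ev (sectionAction T ((frameLift T i).restrict hi) (c i j k)) z).1) e4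
  exact e5.trans (hc.ev_sectionAction_frameLift i j k hi x hx q rfl)

end Obstruction

end DiffGerbe

end

theorem mainTheorem7
    {X A Ghat G : Type u} [TopologicalSpace X] [DiffeologicalSpace X] [IsDTopologyCompatible X]
    [CommGroup A] [Group Ghat] [Group G]
    [DiffeologicalSpace A] [DiffeologicalSpace Ghat] [DiffeologicalSpace G]
    [DiffGerbe.DiffeologicalGroup A] [DiffGerbe.DiffeologicalGroup Ghat]
    [DiffGerbe.DiffeologicalGroup G]
    (E : DiffGerbe.TwistedCentralExtension A Ghat G) (hE : E.LiftsLocallyOn X)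
    (P : DiffGerbe.PrincipalBundle E.H (⊤ : Opens X)) (T : DiffGerbe.Trivialization P) :
    DiffGerbe.IsGerbe (DiffGerbe.liftingGerbe P) ∧
    ∃ θ : DiffGerbe.Banding (DiffGerbe.liftingGerbe P) (DiffGerbe.localSystem E T.twist),
      DiffGerbe.IsCanonicalBanding T θ ∧
      ∀ l : T.Lifts, ∃ a : T.cover.Z2 (DiffGerbe.localSystem E T.twist),
        DiffGerbe.IsObstructionCochain T l a.1 ∧ DiffGerbe.IsGerbeClass θ (DiffGerbe.CechH2.mk a) :=
  by
  have hG := DiffGerbe.liftingGerbe_isGerbe hE P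
  refine ⟨hG, DiffGerbe.canonicalBanding T, DiffGerbe.isCanonicalBanding_canonicalBanding T,
    fun l ↦ ?_⟩
  obtain ⟨c, hc⟩ := DiffGerbe.exists_obstructionCochain l
  exact ⟨⟨c, hc.hasCochain.mem_Z2 hG⟩, hc, DiffGerbe.isGerbeClass_of_hasCochain
    (D := DiffGerbe.gerbeChoice l) (c := ⟨c, hc.hasCochain.mem_Z2 hG⟩) hG hc.hasCochain⟩
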